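/- Let $G=(V,E)$ be a finite weighted undirected graph without loops on $n$ vertices, with weights $w_{uv}=w_{vu}>0$ on the edges and $w_{uv}=0$ off the edges, and suppose that every degree $d(u)=\sum_{v}w_{uv}$ is positive. Let $\lambda_1\le\cdots\le\lambda_n$ be the eigenvalues, with multiplicity, of the normalized Laplacian $D^{-1/2}(D-A)D^{-1/2}$, where $A=(w_{uv})$ and $D$ is the diagonal matrix of the degrees. For disjoint $S,S'\subseteq V$ with $S\cup S'\neq\emptyset$, the bipartite conductance is $$\tilde\phi_G(S,S')=\frac{\sum_{u\in S\cup S'}\sum_{v\notin S\cup S'}w_{uv}+\sum_{u,v\in S}w_{uv}+\sum_{u,v\in S'}w_{uv}}{\sum_{u\in S\cup S'}d(u)},$$ where the last two sums of the numerator run over ordered pairs. There is an absolute constant $C>0$ such that for every such graph $G$ and every integer $k$ with $1\le k\le n$ the following hold. (A) There are $2k$ pairwise disjoint sets $S_1,S_1',\ldots,S_k,S_k'\subseteq V$ with $S_i\cup S_i'\ne\emptyset$ and $$\tilde\phi_G(S_i,S_i')\le C\,\frac{k^2}{k+1-i}\,\sqrt{2-\lambda_{n+1-k}}\qquad(1\le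 i\le k).$$ (B) With $r=\lfloor k/4\rfloor$, there are $2r$ pairwise disjoint sets $S_1,S_1',\ldots,S_r,S_r'\subseteq V$ with $S_i\cup S_i'\neq\emptyset$ and $$\tilde\phi_G(S_i,S_i')\le C\sqrt{\log(k)\,(2-\lambda_{n+1-k})}\qquad(1\le i\le r).$$ -/

import Mathlib

/-- A finite weighted undirected graph without loops: the weights are symmetric, positive on the
edges and zero off the edges. -/
structure WeightedGraph (V : Type*) extends SimpleGraph V where
  weight : V → V → ℝ
  weight_symm : ∀ u v, weight u v = weight v u
  weight_pos : ∀ u v, Adj u v → 0 < weight u v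
  weight_eq_zero : ∀ u v, ¬ Adj u v → weight u v = 0

namespace WeightedGraph

section

variable {V : Type*} [Fintype V] [DecidableEq V] (G : WeightedGraph V)

/-- The weighted degree `d(u)`. -/
noncomputable def deg (u : V) : ℝ := ∑ v, G.weight u v

/-- The weighted adjacency matrix `A`. -/
def adjacency : Matrix V V ℝ := Matrix.of G.weight

/-- The matrix `D^{-1/2}`, for `D` the diagonal matrix of the degrees. -/
noncomputable def degInvSqrt : Matrix V V ℝ := Matrix.diagonal fun u => (√(G.deg u))⁻¹

/-- The normalized Laplacian `D^{-1/2} (D - A) D^{-1/2}`. -/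
noncomputable def normalizedLaplacian : Matrix V V ℝ :=
  G.degInvSqrt * (Matrix.diagonal G.deg - G.adjacency) * G.degInvSqrt

theorem isHermitian_normalizedLaplacian : G.normalizedLaplacian.IsHermitian := by
  have hA : G.adjacency.transpose = G.adjacency := by
    ext u v
    exact G.weight_symm v u
  simp [Matrix.IsHermitian, normalizedLaplacian, degInvSqrt, hA, Matrix.mul_assoc]

/-- The eigenvalues of the normalized Laplacian, with multiplicity and in nondecreasing order,
indexed from `0`: `G.eigenvalue ⟨j - 1, _⟩` is `λ_j`, for `1 ≤ j ≤ n`. (In Mathlib, the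
eigenvalues `eigenvalues₀` are in nonincreasing order.) -/
noncomputable def eigenvalue (j : Fin (Fintype.card V)) : ℝ :=
  G.isHermitian_normalizedLaplacian.eigenvalues₀ j.rev

theorem eigenvalue_mono : Monotone G.eigenvalue := fun _ _ h =>
  G.isHermitian_normalizedLaplacian.eigenvalues₀_antitone (Fin.rev_le_rev.mpr h)

/-- `‖C(T)‖`: the total weight of the stubs incident with `T`. -/
noncomputable def stubWeight (T : Finset V) : ℝ := ∑ u ∈ T, G.deg u

/-- `‖B(T)‖`: the total weight of the stubs incident with `T` whose other end is outside `T`. -/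
noncomputable def boundaryWeight (T : Finset V) : ℝ := ∑ u ∈ T, ∑ v ∈ Tᶜ, G.weight u v

/-- Twice the total weight of the edges with both ends in `T` (the sum runs over ordered pairs,
so that each edge is counted twice). -/
noncomputable def internalWeight (T : Finset V) : ℝ := ∑ u ∈ T, ∑ v ∈ T, G.weight u v

/-- The bipartite conductance of a pair of disjoint vertex sets. -/
noncomputable def bipartiteConductance (S S' : Finset V) : ℝ :=
  (G.boundaryWeight (S ∪ S') + (G.internalWeight S + G.internalWeight S')) /
    G.stubWeight (S ∪ S')

end

/-- `r` disjoint bipartite communities `(S₁, S'₁), …, (S_r, S'_r)`: the `2r` sets are pairwise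
disjoint, and no community `S_i ∪ S'_i` is empty (one of its two sides may be). -/
structure IsCommunityFamily {V : Type*} [DecidableEq V] {r : ℕ} (S S' : Fin r → Finset V) :
    Prop where
  disjoint : Pairwise fun a b : Fin r ⊕ Fin r => Disjoint (Sum.elim S S' a) (Sum.elim S S' b)
  nonempty : ∀ i, (S i ∪ S' i).Nonempty

end WeightedGraph

/-! Let F(u) = d(u)^(-1/2) (e_1(u), ..., e_k(u)), with e_i orthonormal eigenvectors for the k
largest eigenvalues. Then ∑ d(u) F(u)F(u)ᵀ is the identity and ∑ w_uv ‖F(u) + F(v)‖² ≤ 2k(2 -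
λ_{n+1-k}), so edges tend to join nearly opposite vectors (`exists_spectral_embedding`).

Give u the mass d(u)‖F(u)‖². The total mass is k, and isotropy also gives ∑ d(u)d(v)⟨F(u), F(v)⟩² =
k, so a class of nearly parallel vectors has mass at most about 1. Opposite vectors span the same
line; hence the lines, encoded by `rankOne`, are clustered. Correlated sampling from Gaussians of
width about 1/s (`exists_partition_of_sets`, `exists_gaussian_sets`) gives a partition that cuts
edges at a cost O(s · `edgeCost`) and seldom keeps non-parallel vectors together
(`exists_partition`).

If y bounds the expected non-parallel overlap, the class masses satisfy ∑ m = k and ∑ m² ≤ k + 2y,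
and `exists_groups` merges the classes into more than k - 2y - 1/2 groups of mass at least 1/4. A
bipartite Cheeger sweep in each group (`exists_sweep_of_vector`) produces the communities
(`exists_communities`). Part (A) takes s = 2k, y = 1/4; part (B) takes s = 4√(log k), y = k/4. -/

open MeasureTheory

/-! ### Derandomized correlated sampling of a partition -/

theorem exists_mem_nonpos_of_integral_nonpos {X : Type*} [MeasurableSpace X] {ν : Measure X}
    {g : X → ℝ} (hg : Integrable g ν) (hint : ∫ z, g z ∂ν ≤ 0) {W : Set X} (hW : ν W ≠ 0)
    (hoff : ∀ z ∉ W, g z = 0) : ∃ z ∈ W, g z ≤ 0 := by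
  by_contra! h
  have h0 : 0 ≤ g := fun z => by
    by_cases hz : z ∈ W
    · exact (h z hz).le
    · exact (hoff z hz).ge
  have h1 : ∫ z, g z ∂ν = 0 := le_antisymm hint (integral_nonneg h0)
  rw [integral_eq_zero_iff_of_nonneg h0 hg] at h1
  refine hW (measure_mono_null (fun z hz => ?_) (ae_iff.mp h1))
  exact (h z hz).ne'

open Classical in
/-- Rounding a family of sets of measure one to a partition of the index set, such that two
indices are separated about as often as the symmetric difference of their sets is hit. -/
theorem exists_partition_of_sets {V X : Type*} [MeasurableSpace X] {ν : Measure X}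
    {A : V → Set X} (hA : ∀ v, MeasurableSet (A v)) (hν : ∀ v, ν.real (A v) = 1)
    {a b : V → V → ℝ} (ha : ∀ u v, 0 ≤ a u v) (hb : ∀ u v, 0 ≤ b u v) (U : Finset V) :
    ∃ p : V → V, (∀ v ∈ U, p v ∈ U) ∧
      ∑ u ∈ U, ∑ v ∈ U, (if p u = p v then a u v else b u v) ≤
        ∑ u ∈ U, ∑ v ∈ U, (a u v * ν.real (A u ∩ A v) + b u v * ν.real (symmDiff (A u) (A v))) := by
  induction U using Finset.strongInduction with
  | H U ih =>
    rcases U.eq_empty_or_nonempty with rfl | ⟨u₀, hu₀⟩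
    · exact ⟨id, by simp⟩
    have hfin : ∀ v, ν (A v) ≠ ⊤ := fun v h => by
      have := hν v
      simp [Measure.real, h] at this
    set q : V → V → ℝ := fun u v =>
      a u v * ν.real (A u ∩ A v) + b u v * ν.real (symmDiff (A u) (A v)) with hq
    have hq0 : ∀ u v, 0 ≤ q u v := fun u v =>
      add_nonneg (mul_nonneg (ha u v) measureReal_nonneg) (mul_nonneg (hb u v) measureReal_nonneg)
    have hI : ∀ (c : ℝ) (s : Set X), MeasurableSet s → ν s ≠ ⊤ →
        Integrable (s.indicator fun _ => c) ν := fun c s hs hs' =>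
      (integrable_indicator_iff hs).mpr (integrableOn_const hs')
    have hm1 : ∀ u v, MeasurableSet (A u ∩ A v) := fun u v => (hA u).inter (hA v)
    have hm2 : ∀ u v, MeasurableSet (symmDiff (A u) (A v)) := fun u v => (hA u).symmDiff (hA v)
    have hm3 : ∀ u v, MeasurableSet (A u ∪ A v) := fun u v => (hA u).union (hA v)
    have hf3 : ∀ u v, ν (A u ∪ A v) ≠ ⊤ := fun u v => measure_union_ne_top (hfin u) (hfin v)
    have hf1 : ∀ u v, ν (A u ∩ A v) ≠ ⊤ := fun u v =>
      measure_ne_top_of_subset (Set.inter_subset_left.trans Set.subset_union_left) (hf3 u v)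
    have hf2 : ∀ u v, ν (symmDiff (A u) (A v)) ≠ ⊤ := fun u v =>
      measure_ne_top_of_subset Set.symmDiff_subset_union (hf3 u v)
    -- `g u v z` is what the pair pays if `z` is the next sample, minus its budget `q u v` if `z`
    -- settles the pair. Its integral is q(1 - ν(A u ∪ A v)) ≤ 0, the union having measure at least
    -- 1; so some `z` stays within budget over all pairs.
    set g : V → V → X → ℝ := fun u v z =>
      (A u ∩ A v).indicator (fun _ => a u v) z +
        (symmDiff (A u) (A v)).indicator (fun _ => b u v) z -
        (A u ∪ A v).indicator (fun _ => q u v) z with hg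
    have hgi : ∀ u v, Integrable (g u v) ν := fun u v =>
      ((hI _ _ (hm1 u v) (hf1 u v)).add (hI _ _ (hm2 u v) (hf2 u v))).sub
        (hI _ _ (hm3 u v) (hf3 u v))
    have hgint : ∀ u v, ∫ z, g u v z ∂ν ≤ 0 := fun u v => by
      have h1 : ∫ z, g u v z ∂ν = q u v - ν.real (A u ∪ A v) * q u v := by
        have i12 : Integrable (fun z => (A u ∩ A v).indicator (fun _ => a u v) z +
            (symmDiff (A u) (A v)).indicator (fun _ => b u v) z) ν :=
          (hI _ _ (hm1 u v) (hf1 u v)).add (hI _ _ (hm2 u v) (hf2 u v))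
        simp only [hg]
        rw [integral_sub i12 (hI _ _ (hm3 u v) (hf3 u v)),
          integral_add (hI _ _ (hm1 u v) (hf1 u v)) (hI _ _ (hm2 u v) (hf2 u v)),
          integral_indicator_const _ (hm1 u v), integral_indicator_const _ (hm2 u v),
          integral_indicator_const _ (hm3 u v)]
        simp only [smul_eq_mul, hq]
        ring
      have h2 : 1 ≤ ν.real (A u ∪ A v) := by
        rw [← hν u]
        exact measureReal_mono Set.subset_union_left (hf3 u v)
      rw [h1]
      nlinarith [hq0 u v]
    obtain ⟨z, hzW, hz⟩ := exists_mem_nonpos_of_integral_nonpos (ν := ν)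
      (g := fun z => ∑ u ∈ U, ∑ v ∈ U, g u v z) (W := ⋃ u ∈ U, A u)
      (integrable_finsetSum _ fun u _ => integrable_finsetSum _ fun v _ => hgi u v)
      (by
        rw [integral_finsetSum _ fun u _ => integrable_finsetSum _ fun v _ => hgi u v]
        refine Finset.sum_nonpos fun u _ => ?_
        rw [integral_finsetSum _ fun v _ => hgi u v]
        exact Finset.sum_nonpos fun v _ => hgint u v)
      (fun h => by
        have h1 : ν (A u₀) = 0 := measure_mono_null (Set.subset_biUnion_of_mem hu₀) h
        have := hν u₀
        simp [Measure.real, h1] at this)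
      (fun z hz => by
        simp only [Set.mem_iUnion, not_exists] at hz
        refine Finset.sum_eq_zero fun u hu => Finset.sum_eq_zero fun v hv => ?_
        simp [hg, hz u hu, hz v hv, Set.mem_symmDiff])
    simp only [Set.mem_iUnion, exists_prop] at hzW
    obtain ⟨t, htU, ht⟩ := hzW
    -- The vertices whose sets contain `z` form one class, labelled by a member `t`. The other
    -- vertices are partitioned recursively with labels among themselves, so `t` is never reused.
    obtain ⟨p, hpU, hp⟩ := ih (U.filter fun v => z ∉ A v)
      (Finset.filter_ssubset.mpr ⟨t, htU, by simpa using ht⟩)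
    refine ⟨fun v => if z ∈ A v then t else p v, fun v hv => ?_, ?_⟩
    · by_cases h : z ∈ A v
      · simpa [h] using htU
      · simpa [h] using (Finset.mem_filter.mp (hpU v (Finset.mem_filter.mpr ⟨hv, h⟩))).1
    · have key : ∀ u ∈ U, ∀ v ∈ U,
          (if (if z ∈ A u then t else p u) = (if z ∈ A v then t else p v) then a u v else b u v) =
            g u v z + q u v + (if z ∉ A u then if z ∉ A v then
              (if p u = p v then a u v else b u v) - q u v else 0 else 0) := by
        intro u hu v hv
        have hne : ∀ w ∈ U, z ∉ A w → p w ≠ t := fun w hw hzw h => by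
          have := (Finset.mem_filter.mp (hpU w (Finset.mem_filter.mpr ⟨hw, hzw⟩))).2
          exact this (h ▸ ht)
        by_cases h1 : z ∈ A u <;> by_cases h2 : z ∈ A v
        · simp [hg, h1, h2, Set.mem_symmDiff]
        · simp [hg, h1, h2, Set.mem_symmDiff, (hne v hv h2).symm]
        · simp [hg, h1, h2, Set.mem_symmDiff, (hne u hu h1)]
        · simp [hg, h1, h2, Set.mem_symmDiff]
      rw [Finset.sum_congr rfl fun u hu => Finset.sum_congr rfl fun v hv => key u hu v hv]
      change _ ≤ ∑ u ∈ U, ∑ v ∈ U, q u v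
      change _ ≤ ∑ u ∈ U with z ∉ A u, ∑ v ∈ U with z ∉ A v, q u v at hp
      simp only [Finset.sum_add_distrib]
      simp only [Finset.sum_filter] at hp
      have h3 : ∑ u ∈ U, ∑ v ∈ U, (if z ∉ A u then if z ∉ A v then
              (if p u = p v then a u v else b u v) - q u v else 0 else 0) =
          (∑ u ∈ U, if z ∉ A u then ∑ v ∈ U, if z ∉ A v then
            (if p u = p v then a u v else b u v) else 0 else 0) -
          ∑ u ∈ U, if z ∉ A u then ∑ v ∈ U, if z ∉ A v then q u v else 0 else 0 := by
        rw [← Finset.sum_sub_distrib]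
        refine Finset.sum_congr rfl fun u _ => ?_
        by_cases h : z ∈ A u
        · simp [h]
        · simp only [h, not_false_eq_true, if_true, ← Finset.sum_sub_distrib]
          refine Finset.sum_congr rfl fun v _ => ?_
          split_ifs <;> simp
      rw [h3]
      linarith

/-! ### Gaussian regions -/

/-- With r = √(fg), |f - g| is the product of |√f - √g| and √f + √g, and the bound is AM-GM with
weight δ. Integrated, it bounds an L¹ distance by a Hellinger distance. -/
theorem abs_sub_le_of_sq_eq_mul {f g r δ : ℝ} (hf : 0 ≤ f) (hg : 0 ≤ g) (hr : 0 ≤ r)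
    (h : r ^ 2 = f * g) (hδ : 0 < δ) :
    |f - g| ≤ (f + g - 2 * r) / (2 * δ) + δ * (f + g + 2 * r) / 2 := by
  have hP : 0 ≤ f + g - 2 * r := by nlinarith [sq_nonneg (f - g), sq_nonneg (f + g - 2 * r)]
  have hR : 0 ≤ (f + g - 2 * r) / (2 * δ) + δ * (f + g + 2 * r) / 2 := by positivity
  refine abs_le_of_sq_le_sq ?_ hR
  have h1 : (f - g) ^ 2 = 4 * ((f + g - 2 * r) / (2 * δ)) * (δ * (f + g + 2 * r) / 2) := by
    field_simp
    linear_combination 16 * h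
  rw [h1]
  nlinarith [sq_nonneg ((f + g - 2 * r) / (2 * δ) - δ * (f + g + 2 * r) / 2)]

/-- The regions under the graphs of translated Gaussian densities. -/
theorem exists_gaussian_sets {E : Type*} [NormedAddCommGroup E] [InnerProductSpace ℝ E]
    [FiniteDimensional ℝ E] [MeasurableSpace E] [BorelSpace E] {s : ℝ} (hs : 0 < s) :
    ∃ A : E → Set (E × ℝ), (∀ x, MeasurableSet (A x)) ∧
      (∀ x, ((volume : Measure E).prod (volume : Measure ℝ)).real (A x) = 1) ∧
      (∀ x y, ((volume : Measure E).prod (volume : Measure ℝ)).real (A x ∩ A y) ≤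
        Real.exp (-(s ^ 2 * ‖x - y‖ ^ 2))) ∧
      ∀ x y, ((volume : Measure E).prod (volume : Measure ℝ)).real (symmDiff (A x) (A y)) ≤
        3 * s * ‖x - y‖ := by
  -- With this β, the parallelogram law makes the geometric mean of the densities at x and y equal
  -- to exp(-s²‖x - y‖²) times the density at the midpoint. This mean dominates the minimum, whose
  -- integral is the overlap.
  set β : ℝ := 4 * s ^ 2 with hβ
  have hβ0 : 0 < β := by positivity
  set c : ℝ := ∫ z : E, Real.exp (-β * ‖z‖ ^ 2) with hc
  have hc0 : 0 < c := by
    rw [hc, GaussianFourier.integral_rexp_neg_mul_sq_norm hβ0]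
    positivity
  have hI0 : Integrable (fun z : E => Real.exp (-β * ‖z‖ ^ 2)) := by
    by_contra h
    exact hc0.ne' (by rw [hc, integral_undef h])
  set f : E → E → ℝ := fun x z => c⁻¹ * Real.exp (-β * ‖z - x‖ ^ 2) with hf
  have hfc : ∀ x, Continuous (f x) := fun x => by fun_prop
  have hf0 : ∀ x z, 0 ≤ f x z := fun x z => by positivity
  have hfI : ∀ x, Integrable (f x) := fun x => (hI0.comp_sub_right x).const_mul _
  have hf1 : ∀ x, ∫ z, f x z = 1 := fun x => by
    simp only [hf, integral_const_mul]
    rw [integral_sub_right_eq_self (fun z : E => Real.exp (-β * ‖z‖ ^ 2)) x]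
    exact inv_mul_cancel₀ hc0.ne'
  set ν := (volume : Measure E).prod (volume : Measure ℝ) with hν
  have hreg : ∀ g : E → ℝ, Integrable g → 0 ≤ g →
      ν.real (regionBetween 0 g Set.univ) = ∫ z, g z := fun g hg hg0 => by
    rw [Measure.real, volume_regionBetween_eq_integral (integrable_zero _ _ _).integrableOn
      hg.integrableOn MeasurableSet.univ (fun z _ => hg0 z)]
    simp only [Pi.sub_apply, Pi.zero_apply, sub_zero, Measure.restrict_univ]
    exact ENNReal.toReal_ofReal (integral_nonneg hg0)
  have hA : ∀ x, MeasurableSet (regionBetween 0 (f x) Set.univ) := fun x =>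
    measurableSet_regionBetween measurable_zero (hfc x).measurable MeasurableSet.univ
  have hA1 : ∀ x, ν.real (regionBetween 0 (f x) Set.univ) = 1 := fun x => by
    rw [hreg _ (hfI x) (hf0 x), hf1]
  have hAtop : ∀ x, ν (regionBetween 0 (f x) Set.univ) ≠ ⊤ := fun x h => by
    have := hA1 x
    simp [Measure.real, h] at this
  have hminI : ∀ x y, Integrable (fun z => min (f x z) (f y z)) := fun x y => (hfI x).inf (hfI y)
  have hinter : ∀ x y, ν.real (regionBetween 0 (f x) Set.univ ∩ regionBetween 0 (f y) Set.univ) =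
      ∫ z, min (f x z) (f y z) := fun x y => by
    rw [← hreg _ (hminI x y) (fun z => le_min (hf0 x z) (hf0 y z))]
    congr 1
    ext ⟨z, w⟩
    simp only [regionBetween, Set.mem_inter_iff, Set.mem_ofPred_eq, Set.mem_univ, true_and,
      Set.mem_Ioo, Pi.zero_apply, lt_min_iff]
    tauto
  set h : E → E → ℝ := fun x y => Real.exp (-(s ^ 2 * ‖x - y‖ ^ 2)) with hh
  set r : E → E → E → ℝ := fun x y z => h x y * f ((2 : ℝ)⁻¹ • (x + y)) z with hr
  have hr0 : ∀ x y z, 0 ≤ r x y z := fun x y z => mul_nonneg (Real.exp_nonneg _) (hf0 _ _)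
  have hrI : ∀ x y, Integrable (r x y) := fun x y => (hfI _).const_mul _
  have hr1 : ∀ x y, ∫ z, r x y z = h x y := fun x y => by
    simp only [hr, integral_const_mul, hf1, mul_one]
  have hrsq : ∀ x y z, r x y z ^ 2 = f x z * f y z := fun x y z => by
    have e1 : ‖z - x‖ ^ 2 + ‖z - y‖ ^ 2 =
        2 * ‖z - (2 : ℝ)⁻¹ • (x + y)‖ ^ 2 + ‖x - y‖ ^ 2 / 2 := by
      have h1 := parallelogram_law_with_norm ℝ (z - x) (z - y)
      have h2 : (z - x) + (z - y) = (2 : ℝ) • (z - (2 : ℝ)⁻¹ • (x + y)) := by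
        rw [smul_sub, smul_smul]; norm_num; rw [two_smul]; abel
      have h3 : (z - x) - (z - y) = -(x - y) := by abel
      rw [h2, h3, norm_neg, norm_smul, Real.norm_ofNat] at h1
      linarith
    simp only [hr, hh, hf]
    rw [mul_pow, mul_pow, ← Real.exp_nat_mul, ← Real.exp_nat_mul, mul_mul_mul_comm,
      ← Real.exp_add, ← sq, mul_left_comm, ← Real.exp_add]
    congr 2
    rw [hβ]
    push_cast
    linear_combination (4 * s ^ 2) * e1
  have hle : ∀ x y z, min (f x z) (f y z) ≤ r x y z := fun x y z => by
    refine abs_le_of_sq_le_sq' ?_ (hr0 x y z) |>.2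
    rw [hrsq, sq]
    exact mul_le_mul (min_le_left _ _) (min_le_right _ _) (le_min (hf0 _ _) (hf0 _ _)) (hf0 _ _)
  refine ⟨fun x => regionBetween 0 (f x) Set.univ, hA, hA1, fun x y => ?_, fun x y => ?_⟩
  · rw [hinter]
    exact (integral_mono (hminI x y) (hrI x y) (hle x y)).trans_eq (hr1 x y)
  · rcases eq_or_ne x y with rfl | hxy
    · simp
    -- Since 1 - h ≤ δ² and h ≤ 1, this weight turns (1 - h)/δ + δ(1 + h) into at most 3δ.
    set δ := s * ‖x - y‖ with hδ
    have hδ0 : 0 < δ := mul_pos hs (norm_pos_iff.mpr (sub_ne_zero.mpr hxy))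
    have hsd : ν.real (symmDiff (regionBetween 0 (f x) Set.univ) (regionBetween 0 (f y) Set.univ))
        = 2 - 2 * ∫ z, min (f x z) (f y z) := by
      rw [measureReal_symmDiff_eq (μ := ν) (hA x) (hA y) (hAtop x) (hAtop y)]
      have e1 := measureReal_sdiff_add_inter (μ := ν) (s := regionBetween 0 (f x) Set.univ) (hA y)
        (hAtop x)
      have e2 := measureReal_sdiff_add_inter (μ := ν) (s := regionBetween 0 (f y) Set.univ) (hA x)
        (hAtop y)
      rw [Set.inter_comm, hinter, hA1] at e2
      rw [hinter, hA1] at e1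
      linarith
    have hmin : (1 - h x y) / δ + δ * (1 + h x y) ≥ 2 - 2 * ∫ z, min (f x z) (f y z) := by
      have hint : ∫ z, (f x z + f y z - ((f x z + f y z - 2 * r x y z) * (2 * δ)⁻¹ +
          (f x z + f y z + 2 * r x y z) * (δ / 2))) ≤ ∫ z, 2 * min (f x z) (f y z) := by
        refine integral_mono ?_ ((hminI x y).const_mul 2) fun z => ?_
        · exact ((hfI x).add (hfI y)).sub ((((((hfI x).add (hfI y)).sub
            ((hrI x y).const_mul 2))).mul_const _).add
            (((((hfI x).add (hfI y)).add ((hrI x y).const_mul 2))).mul_const _))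
        · have := abs_sub_le_of_sq_eq_mul (hf0 x z) (hf0 y z) (hr0 x y z) (hrsq x y z) hδ0
          have h2 : 2 * min (f x z) (f y z) = f x z + f y z - |f x z - f y z| := by
            rcases le_total (f x z) (f y z) with h | h
            · rw [min_eq_left h, abs_of_nonpos (sub_nonpos.mpr h)]; ring
            · rw [min_eq_right h, abs_of_nonneg (sub_nonneg.mpr h)]; ring
          simp only
          rw [h2]
          rw [div_eq_mul_inv] at this
          linarith
      have i1 : Integrable (fun z => f x z + f y z) := (hfI x).add (hfI y)
      have i2 : Integrable (fun z => 2 * r x y z) := (hrI x y).const_mul 2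
      have i3 : Integrable (fun z => (f x z + f y z - 2 * r x y z) * (2 * δ)⁻¹) :=
        (i1.sub i2).mul_const _
      have i4 : Integrable (fun z => (f x z + f y z + 2 * r x y z) * (δ / 2)) :=
        (i1.add i2).mul_const _
      have i34 : Integrable (fun z => (f x z + f y z - 2 * r x y z) * (2 * δ)⁻¹ +
          (f x z + f y z + 2 * r x y z) * (δ / 2)) := i3.add i4
      rw [integral_sub i1 i34, integral_add i3 i4, integral_mul_const,
        integral_mul_const, integral_sub i1 i2, integral_add i1 i2, integral_add (hfI x) (hfI y),
        hf1, hf1, integral_const_mul 2 (r x y), hr1, integral_const_mul] at hint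
      have : (1 - h x y) / δ = (1 + 1 - 2 * h x y) * (2 * δ)⁻¹ := by field_simp; ring
      rw [this]
      linarith
    have hh1 : 1 - h x y ≤ δ ^ 2 := by
      have := Real.add_one_le_exp (-(s ^ 2 * ‖x - y‖ ^ 2))
      simp only [hh, hδ, mul_pow]
      linarith
    have hh2 : h x y ≤ 1 := Real.exp_le_one_iff.mpr (by
      have : 0 ≤ s ^ 2 * ‖x - y‖ ^ 2 := by positivity
      linarith)
    rw [hsd]
    have h3 : (1 - h x y) / δ ≤ δ := by
      rw [div_le_iff₀ hδ0]; nlinarith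
    calc _ ≤ _ := hmin
      _ ≤ δ + δ * 2 := by
        have : δ * (1 + h x y) ≤ δ * 2 := mul_le_mul_of_nonneg_left (by linarith) hδ0.le
        linarith
      _ = _ := by rw [hδ]; ring

/-! ### Merging classes and ordering by cost -/

/-- Merging small items: items of any sizes can be gathered into disjoint groups of size at least
`1/4`, the number of which is controlled by the first two moments. -/
theorem exists_groups {ι : Type*} [DecidableEq ι] (m : ι → ℝ) (s : Finset ι) :
    ∃ 𝒬 : Finset (Finset ι), (𝒬 : Set (Finset ι)).PairwiseDisjoint id ∧
      (∀ Q ∈ 𝒬, Q ⊆ s ∧ 1 / 4 ≤ ∑ x ∈ Q, m x) ∧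
      ∑ x ∈ s, (2 * m x - m x ^ 2) < (𝒬.card : ℝ) + 1 / 2 := by
  -- Greedy invariant with an unfinished group `L` of size below 1/4. A big item is a group by
  -- itself and adds 2m - m² ≤ 1. A small one joins `L`; if that reaches 1/4, the closed group has
  -- size below 1/2, so its contribution 2m(L) stays below 1.
  suffices h : ∃ 𝒬 : Finset (Finset ι), ∃ L : Finset ι, (𝒬 : Set (Finset ι)).PairwiseDisjoint id ∧
      (∀ Q ∈ 𝒬, Q ⊆ s ∧ 1 / 4 ≤ ∑ x ∈ Q, m x) ∧ L ⊆ s ∧ (∀ Q ∈ 𝒬, Disjoint L Q) ∧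
      ∑ x ∈ L, m x < 1 / 4 ∧ ∑ x ∈ s, (2 * m x - m x ^ 2) ≤ (𝒬.card : ℝ) + 2 * ∑ x ∈ L, m x by
    obtain ⟨𝒬, L, h1, h2, -, -, h3, h4⟩ := h
    exact ⟨𝒬, h1, h2, by linarith⟩
  induction s using Finset.induction_on with
  | empty => exact ⟨∅, ∅, by simp⟩
  | insert i s hi ih =>
    obtain ⟨𝒬, L, hd, hQ, hLs, hLd, hL, hsum⟩ := ih
    rw [Finset.sum_insert hi]
    have hiQ : ∀ Q ∈ 𝒬, i ∉ Q := fun Q h hiQ => hi ((hQ Q h).1 hiQ)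
    have hiL : i ∉ L := fun h => hi (hLs h)
    have hQ' : ∀ Q ∈ 𝒬, Q ⊆ insert i s ∧ 1 / 4 ≤ ∑ x ∈ Q, m x := fun Q h =>
      ⟨(hQ Q h).1.trans (Finset.subset_insert _ _), (hQ Q h).2⟩
    have hins : ∀ P : Finset ι, i ∈ P → (∀ Q ∈ 𝒬, Disjoint P Q) →
        ((insert P 𝒬 : Finset (Finset ι)) : Set (Finset ι)).PairwiseDisjoint id ∧
          (((insert P 𝒬 : Finset (Finset ι)).card : ℝ) = 𝒬.card + 1) := fun P hP h => by
      refine ⟨?_, ?_⟩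
      · rw [Finset.coe_insert]
        exact hd.insert fun Q hQ _ => h Q hQ
      · rw [Finset.card_insert_of_notMem fun h => hiQ P h hP]
        push_cast
        rfl
    by_cases hbig : 1 / 4 ≤ m i
    · obtain ⟨e1, e2⟩ := hins {i} (by simp) fun Q h => by simpa using hiQ Q h
      refine ⟨insert {i} 𝒬, L, e1, ?_, hLs.trans (Finset.subset_insert _ _), ?_, hL, ?_⟩
      · simp only [Finset.mem_insert, forall_eq_or_imp]
        exact ⟨⟨by simp, by simpa using hbig⟩, hQ'⟩
      · simp only [Finset.mem_insert, forall_eq_or_imp]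
        exact ⟨by simpa using hiL, hLd⟩
      · rw [e2]
        nlinarith [sq_nonneg (m i - 1)]
    · have hLi : ∑ x ∈ insert i L, m x = m i + ∑ x ∈ L, m x := Finset.sum_insert hiL
      have hdi : ∀ Q ∈ 𝒬, Disjoint (insert i L) Q := fun Q h =>
        Finset.disjoint_insert_left.mpr ⟨hiQ Q h, hLd Q h⟩
      by_cases hlt : ∑ x ∈ insert i L, m x < 1 / 4
      · refine ⟨𝒬, insert i L, hd, hQ', Finset.insert_subset_insert _ hLs, hdi, hlt, ?_⟩
        rw [hLi]
        nlinarith [sq_nonneg (m i)]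
      · obtain ⟨e1, e2⟩ := hins (insert i L) (by simp) hdi
        refine ⟨insert (insert i L) 𝒬, ∅, e1, ?_, by simp, by simp, by simp, ?_⟩
        · simp only [Finset.mem_insert, forall_eq_or_imp]
          exact ⟨⟨Finset.insert_subset_insert _ hLs, not_lt.mp hlt⟩, hQ'⟩
        · rw [e2, Finset.sum_empty]
          nlinarith [sq_nonneg (m i)]

/-- Enumerating a finite set by increasing cost: the cost of the `i`-th element is at most the
total cost divided by the number of elements from the `i`-th one on. -/
theorem exists_enumeration_le {α : Type*} (s : Finset α) {c : α → ℝ} (hc : ∀ a ∈ s, 0 ≤ c a)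
    {X : ℝ} (hX : ∑ a ∈ s, c a ≤ X) :
    ∃ e : Fin s.card → α, Function.Injective e ∧ (∀ i, e i ∈ s) ∧
      ∀ i, ((s.card : ℝ) - i) * c (e i) ≤ X := by
  set e₀ : Fin s.card ≃ s := s.equivFin.symm
  set σ := Tuple.sort fun i => c (e₀ i)
  have hmono : Monotone fun i => c (e₀ (σ i)) := Tuple.monotone_sort fun i => c (e₀ i)
  refine ⟨fun i => e₀ (σ i), ?_, fun i => (e₀ (σ i)).2, fun i => ?_⟩
  · exact Subtype.val_injective.comp (e₀.injective.comp σ.injective)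
  · have h1 : ∑ j, c (e₀ (σ j)) = ∑ a ∈ s, c a := by
      rw [Equiv.sum_comp σ fun j => c (e₀ j), Equiv.sum_comp e₀ fun a => c a,
        Finset.sum_coe_sort s c]
    have h2 : ∑ j ∈ Finset.Ici i, c (e₀ (σ i)) ≤ ∑ j, c (e₀ (σ j)) :=
      (Finset.sum_le_sum fun j hj => hmono (Finset.mem_Ici.mp hj)).trans
        (Finset.sum_le_sum_of_subset_of_nonneg (Finset.subset_univ _)
          fun j _ _ => hc _ (e₀ (σ j)).2)
    rw [Finset.sum_const, Fin.card_Ici, nsmul_eq_mul, Nat.cast_sub i.2.le] at h2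
    exact h2.trans (h1.le.trans hX)

/-! ### Bipartite Cheeger sweep -/

theorem integral_level_indicator {A : ℝ} (c : ℝ) (hA : 0 ≤ A) :
    Integrable ((Set.Ioc 0 A).indicator fun _ => c) ∧
      ∫ t : ℝ, (Set.Ioc 0 A).indicator (fun _ => c) t = A * c := by
  refine ⟨(integrable_indicator_iff measurableSet_Ioc).mpr (integrableOn_const (by simp)), ?_⟩
  rw [integral_indicator_const _ measurableSet_Ioc]
  simp [Measure.real, hA]

namespace WeightedGraph

theorem weight_nonneg {V : Type*} (G : WeightedGraph V) (u v : V) : 0 ≤ G.weight u v := by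
  by_cases h : G.Adj u v
  · exact (G.weight_pos u v h).le
  · exact (G.weight_eq_zero u v h).ge

variable {V : Type*} [Fintype V] (G : WeightedGraph V)

theorem bipartiteConductance_nonneg [DecidableEq V] (S S' : Finset V) :
    0 ≤ G.bipartiteConductance S S' := by
  have h := G.weight_nonneg
  have hs : ∀ s t : Finset V, 0 ≤ ∑ u ∈ s, ∑ v ∈ t, G.weight u v := fun s t =>
    Finset.sum_nonneg fun u _ => Finset.sum_nonneg fun v _ => h u v
  exact div_nonneg (add_nonneg (hs _ _) (add_nonneg (hs _ _) (hs _ _)))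
    (Finset.sum_nonneg fun u _ => Finset.sum_nonneg fun v _ => h u v)

/-- The two sides of the sweep cut of `f` at level `t`. -/
noncomputable def sweep (f : V → ℝ) (t : ℝ) : Finset V :=
  {u | 0 < f u ∧ t ≤ f u ^ 2}

/-- The sweep argument for the bipartite conductance. -/
theorem exists_sweep [DecidableEq V] (f : V → ℝ) (hf : 0 < ∑ u, G.deg u * f u ^ 2) :
    ∃ S S' : Finset V, Disjoint S S' ∧ (S ∪ S').Nonempty ∧ (∀ u ∈ S ∪ S', f u ≠ 0) ∧
      G.bipartiteConductance S S' * ∑ u, G.deg u * f u ^ 2 ≤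
        ∑ u, ∑ v, G.weight u v * (|f u + f v| * (|f u| + |f v|)) := by
  set K := ∑ u, G.deg u * f u ^ 2 with hK
  set X := ∑ u, ∑ v, G.weight u v * (|f u + f v| * (|f u| + |f v|)) with hX
  have hdeg : ∀ u, 0 ≤ G.deg u := fun u => Finset.sum_nonneg fun v _ => G.weight_nonneg u v
  set c : V → V → ℝ := fun u v => if 0 < f u * f v then min (f u ^ 2) (f v ^ 2) else 0 with hc
  have hc0 : ∀ u v, 0 ≤ c u v := fun u v => by simp only [hc]; split_ifs <;> positivity
  set M : V → V → ℝ := fun u v => min (f u ^ 2) (f v ^ 2)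
  have hM0 : ∀ u v, 0 ≤ M u v := fun u v => le_min (sq_nonneg _) (sq_nonneg _)
  -- The left side is the length of the set of levels t > 0 that charge the ordered pair: f(u)² - M
  -- counts u in and v out of the cut, and c counts both on the same side.
  have hpair : ∀ u v, f u ^ 2 - M u v + c u v ≤ |f u + f v| * (|f u| + |f v|) := fun u v => by
    have hsq : f u ^ 2 = |f u| ^ 2 := (sq_abs _).symm
    have hsq' : f v ^ 2 = |f v| ^ 2 := (sq_abs _).symm
    by_cases h : 0 < f u * f v
    · have hcM : c u v = M u v := if_pos h
      have : |f u| + |f v| = |f u + f v| := by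
        rcases pos_and_pos_or_neg_and_neg_of_mul_pos h with ⟨h1, h2⟩ | ⟨h1, h2⟩
        · rw [abs_of_pos h1, abs_of_pos h2, abs_of_pos (add_pos h1 h2)]
        · rw [abs_of_neg h1, abs_of_neg h2, abs_of_neg (add_neg h1 h2)]; ring
      rw [hcM, ← this]
      nlinarith [abs_nonneg (f u), abs_nonneg (f v)]
    · have hc' : c u v = 0 := if_neg h
      have h1 : |f u| - |f v| ≤ |f u + f v| := by
        have := abs_sub_abs_le_abs_sub (f u) (-f v)
        rwa [abs_neg, sub_neg_eq_add] at this
      have h2 : 0 ≤ |f u + f v| * (|f u| + |f v|) := by positivity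
      rw [hc', add_zero]
      rcases le_total (f u ^ 2) (f v ^ 2) with h3 | h3
      · simp only [M]; rw [min_eq_left h3]; linarith
      · simp only [M]
        rw [min_eq_right h3, hsq, hsq']
        nlinarith [abs_nonneg (f u), abs_nonneg (f v)]
  set I : ℝ → ℝ → ℝ → ℝ := fun A c t => (Set.Ioc 0 A).indicator (fun _ => c) t with hI
  have hIi : ∀ A c, 0 ≤ A → Integrable (I A c) := fun A c h => (integral_level_indicator c h).1
  have hIt : ∀ A c, 0 ≤ A → ∫ t, I A c t = A * c := fun A c h => (integral_level_indicator c h).2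
  -- `g t` is K times the numerator minus X times the denominator of the conductance of the cut at
  -- level t. A level with `g t ≤ 0` and a nonempty cut is what is needed.
  set g : ℝ → ℝ := fun t => (∑ u, ∑ v, (I (f u ^ 2) (G.weight u v * K) t -
    I (M u v) (G.weight u v * K) t + I (c u v) (G.weight u v * K) t)) -
      ∑ u, I (f u ^ 2) (G.deg u * X) t with hg
  have i1 : ∀ u v, Integrable (fun t => I (f u ^ 2) (G.weight u v * K) t -
      I (M u v) (G.weight u v * K) t) := fun u v =>
    (hIi _ _ (sq_nonneg _)).sub (hIi _ _ (hM0 u v))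
  have i2 : ∀ u v, Integrable (fun t => I (f u ^ 2) (G.weight u v * K) t -
      I (M u v) (G.weight u v * K) t + I (c u v) (G.weight u v * K) t) := fun u v =>
    (i1 u v).add (hIi _ _ (hc0 u v))
  have i3 : ∀ u, Integrable (fun t => ∑ v, (I (f u ^ 2) (G.weight u v * K) t -
      I (M u v) (G.weight u v * K) t + I (c u v) (G.weight u v * K) t)) := fun u =>
    integrable_finsetSum _ fun v _ => i2 u v
  have i4 : Integrable (fun t => ∑ u, ∑ v, (I (f u ^ 2) (G.weight u v * K) t -
      I (M u v) (G.weight u v * K) t + I (c u v) (G.weight u v * K) t)) :=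
    integrable_finsetSum _ fun u _ => i3 u
  have i5 : Integrable (fun t => ∑ u, I (f u ^ 2) (G.deg u * X) t) :=
    integrable_finsetSum _ fun u _ => hIi _ _ (sq_nonneg _)
  have hgint : ∫ t, g t ≤ 0 := by
    simp only [hg]
    rw [integral_sub i4 i5, integral_finsetSum _ fun u _ => i3 u,
      integral_finsetSum _ fun u _ => hIi _ _ (sq_nonneg _)]
    have e1 : ∀ u, ∫ t, ∑ v, (I (f u ^ 2) (G.weight u v * K) t -
        I (M u v) (G.weight u v * K) t + I (c u v) (G.weight u v * K) t) =
        ∑ v, (f u ^ 2 - M u v + c u v) * (G.weight u v * K) := fun u => by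
      rw [integral_finsetSum _ fun v _ => i2 u v]
      refine Finset.sum_congr rfl fun v _ => ?_
      rw [integral_add (i1 u v) (hIi _ _ (hc0 u v)),
        integral_sub (hIi _ _ (sq_nonneg _)) (hIi _ _ (hM0 u v)), hIt _ _ (sq_nonneg _),
        hIt _ _ (hM0 u v), hIt _ _ (hc0 u v)]
      ring
    simp only [e1, hIt _ _ (sq_nonneg _)]
    have e2 : ∑ u, f u ^ 2 * (G.deg u * X) = X * K := by
      rw [hK, Finset.mul_sum]
      exact Finset.sum_congr rfl fun u _ => by ring
    have e3 : ∑ u, ∑ v, (f u ^ 2 - M u v + c u v) * (G.weight u v * K) ≤ X * K := by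
      rw [hX, Finset.sum_mul]
      refine Finset.sum_le_sum fun u _ => ?_
      rw [Finset.sum_mul]
      refine Finset.sum_le_sum fun v _ => ?_
      have := mul_le_mul_of_nonneg_left (hpair u v) (mul_nonneg (G.weight_nonneg u v) hf.le)
      linarith
    rw [e2]
    linarith
  obtain ⟨u₀, hu₀⟩ : ∃ u, f u ≠ 0 := by
    by_contra! h
    simp [hK, h] at hf
  obtain ⟨t, ht, hgt⟩ := exists_mem_nonpos_of_integral_nonpos (ν := (volume : Measure ℝ))
    (g := g) (W := ⋃ u, Set.Ioc 0 (f u ^ 2)) (i4.sub i5) hgint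
    (fun h => by
      have h1 := measure_mono_null (Set.subset_iUnion (fun u => Set.Ioc 0 (f u ^ 2)) u₀) h
      have : 0 < f u₀ ^ 2 := by positivity
      simp [this.not_ge] at h1)
    (fun t ht => by
      simp only [Set.mem_iUnion, not_exists] at ht
      have h1 : ∀ A c u, A ≤ f u ^ 2 → I A c t = 0 := fun A c u hA =>
        Set.indicator_of_notMem (fun h => ht u ⟨h.1, h.2.trans hA⟩) _
      have h2 : ∀ u v, c u v ≤ f u ^ 2 := fun u v => by
        simp only [hc]; split_ifs
        · exact min_le_left _ _
        · positivity
      simp only [hg]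
      rw [Finset.sum_eq_zero fun u _ => Finset.sum_eq_zero fun v _ => ?_,
        Finset.sum_eq_zero fun u _ => ?_, sub_zero]
      · exact h1 _ _ u le_rfl
      · rw [h1 _ _ u le_rfl, h1 _ _ u (min_le_left _ _), h1 _ _ u (h2 u v)]; ring)
  simp only [Set.mem_iUnion] at ht
  obtain ⟨u₁, ht0, hu₁⟩ := ht
  have hmem : ∀ u, u ∈ sweep f t ∪ sweep (-f) t ↔ t ≤ f u ^ 2 := fun u => by
    simp only [sweep, Finset.mem_union, Finset.mem_filter, Finset.mem_univ, true_and, Pi.neg_apply,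
      neg_sq, Left.neg_pos_iff]
    constructor
    · rintro (h | h) <;> exact h.2
    · intro h
      have : f u ≠ 0 := fun h0 => by simp [h0] at h; linarith
      rcases this.lt_or_gt with h1 | h1
      · exact Or.inr ⟨h1, h⟩
      · exact Or.inl ⟨h1, h⟩
  refine ⟨sweep f t, sweep (-f) t, ?_, ⟨u₁, (hmem _).mpr hu₁⟩, fun u hu h0 => ?_, ?_⟩
  · rw [Finset.disjoint_left]
    intro u h1 h2
    simp only [sweep, Finset.mem_filter, Finset.mem_univ, true_and, Pi.neg_apply,
      Left.neg_pos_iff] at h1 h2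
    linarith
  · have := (hmem u).mp hu
    simp [h0] at this
    linarith
  · set T := sweep f t ∪ sweep (-f) t with hT
    have hIif : ∀ A c, I A c t = if t ≤ A then c else 0 := fun A c => by
      simp [hI, Set.indicator_apply, ht0]
    have hsum : ∀ P Q : Finset V, ∑ u ∈ P, ∑ v ∈ Q, G.weight u v * K =
        ∑ u, ∑ v, if u ∈ P ∧ v ∈ Q then G.weight u v * K else 0 := fun P Q => by
      rw [← Finset.sum_product', ← Finset.sum_product', ← Finset.sum_filter]
      congr 1
      ext ⟨u, v⟩
      simp
    have hD : ∑ u, I (f u ^ 2) (G.deg u * X) t = G.stubWeight T * X := by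
      simp only [hIif, ← hmem]
      rw [stubWeight, Finset.sum_mul, ← Finset.sum_filter]
      congr 1
      ext u
      simp
    have hN : ∑ u, ∑ v, (I (f u ^ 2) (G.weight u v * K) t - I (M u v) (G.weight u v * K) t +
        I (c u v) (G.weight u v * K) t) = (G.boundaryWeight T +
          (G.internalWeight (sweep f t) + G.internalWeight (sweep (-f) t))) * K := by
      simp only [boundaryWeight, internalWeight, add_mul, Finset.sum_mul, hsum, hIif,
        ← Finset.sum_add_distrib]
      refine Finset.sum_congr rfl fun u _ => Finset.sum_congr rfl fun v _ => ?_
      have e1 : t ≤ M u v ↔ t ≤ f u ^ 2 ∧ t ≤ f v ^ 2 := le_min_iff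
      have e2 : t ≤ c u v ↔ 0 < f u * f v ∧ t ≤ f u ^ 2 ∧ t ≤ f v ^ 2 := by
        simp only [hc]
        split_ifs with h
        · simp [h]
        · simp [h, ht0]
      simp only [e1, e2, Finset.mem_compl, hmem]
      simp only [sweep, Finset.mem_filter, Finset.mem_univ, true_and, Pi.neg_apply, neg_sq,
        Left.neg_pos_iff]
      by_cases h1 : t ≤ f u ^ 2 <;> by_cases h2 : t ≤ f v ^ 2
      · have n1 : f u ≠ 0 := fun h0 => by simp [h0] at h1; linarith
        have n2 : f v ≠ 0 := fun h0 => by simp [h0] at h2; linarith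
        rcases n1.lt_or_gt with h3 | h3 <;> rcases n2.lt_or_gt with h4 | h4
        · simp [h1, h2, h3, h4, mul_pos_of_neg_of_neg h3 h4, h3.le.not_gt]
        · simp [h1, h2, h3.le.not_gt, h4.le.not_gt, (mul_neg_of_neg_of_pos h3 h4).le.not_gt]
        · simp [h1, h2, h3.le.not_gt, h4.le.not_gt, (mul_neg_of_pos_of_neg h3 h4).le.not_gt]
        · simp [h1, h2, h3, h4, mul_pos h3 h4, h3.le.not_gt]
      · simp [h1, h2]
      · simp [h1, h2]
      · simp [h1, h2]
    have hX0 : 0 ≤ X := Finset.sum_nonneg fun u _ => Finset.sum_nonneg fun v _ =>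
      mul_nonneg (G.weight_nonneg u v) (by positivity)
    have hs0 : 0 ≤ G.stubWeight T := Finset.sum_nonneg fun u _ => hdeg u
    simp only [hg, hD, hN] at hgt
    rw [bipartiteConductance, div_mul_eq_mul_div]
    exact div_le_of_le_mul₀ hs0 hX0 (by linarith)

/-- Each coordinate, cut off outside `T`, can be swept. The coordinate masses add up to the mass of
`T`, and by Cauchy-Schwarz the coordinate costs add up to at most the vector cost, so some
coordinate of positive mass has at most the average ratio. -/
theorem exists_sweep_of_vector [DecidableEq V] {k : ℕ} (F : V → EuclideanSpace ℝ (Fin k))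
    (T : Finset V)
    (hT : 0 < ∑ u ∈ T, G.deg u * ‖F u‖ ^ 2) :
    ∃ S S' : Finset V, Disjoint S S' ∧ (S ∪ S').Nonempty ∧ S ∪ S' ⊆ T ∧
      G.bipartiteConductance S S' * ∑ u ∈ T, G.deg u * ‖F u‖ ^ 2 ≤
        ∑ u, ∑ v, G.weight u v * (if u ∈ T then
          if v ∈ T then ‖F u + F v‖ * (‖F u‖ + ‖F v‖) else ‖F u‖ ^ 2
          else if v ∈ T then ‖F v‖ ^ 2 else 0) := by
  set f : Fin k → V → ℝ := fun j u => if u ∈ T then F u j else 0 with hf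
  set m := ∑ u ∈ T, G.deg u * ‖F u‖ ^ 2 with hm
  set E : V → V → ℝ := fun u v => if u ∈ T then
          if v ∈ T then ‖F u + F v‖ * (‖F u‖ + ‖F v‖) else ‖F u‖ ^ 2
          else if v ∈ T then ‖F v‖ ^ 2 else 0 with hE
  have hnorm : ∀ x : EuclideanSpace ℝ (Fin k), ‖x‖ = √(∑ j, |x j| ^ 2) := fun x => by
    simp [EuclideanSpace.norm_eq]
  have hnsq : ∀ x : EuclideanSpace ℝ (Fin k), ‖x‖ ^ 2 = ∑ j, x j ^ 2 := fun x => by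
    simp [EuclideanSpace.norm_sq_eq]
  have hcs : ∀ x y : EuclideanSpace ℝ (Fin k), ∑ j, |x j| * |y j| ≤ ‖x‖ * ‖y‖ := fun x y => by
    rw [hnorm x, hnorm y]
    exact Real.sum_mul_le_sqrt_mul_sqrt _ _ _
  have hmass : ∑ j, ∑ u, G.deg u * f j u ^ 2 = m := by
    rw [Finset.sum_comm, hm, ← Finset.sum_filter_add_sum_filter_not Finset.univ (· ∈ T)]
    rw [Finset.sum_eq_zero (s := Finset.univ.filter (¬ · ∈ T)), add_zero]
    · have : Finset.univ.filter (· ∈ T) = T := by ext; simp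
      rw [this]
      refine Finset.sum_congr rfl fun u hu => ?_
      simp [hf, hu, hnsq, Finset.mul_sum]
    · intro u hu
      simp [hf, (Finset.mem_filter.mp hu).2]
  have hcost : ∑ j, ∑ u, ∑ v, G.weight u v * (|f j u + f j v| * (|f j u| + |f j v|)) ≤
      ∑ u, ∑ v, G.weight u v * E u v := by
    rw [Finset.sum_comm]
    refine Finset.sum_le_sum fun u _ => ?_
    rw [Finset.sum_comm]
    refine Finset.sum_le_sum fun v _ => ?_
    rw [← Finset.mul_sum]
    refine mul_le_mul_of_nonneg_left ?_ (G.weight_nonneg u v)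
    by_cases hu : u ∈ T <;> by_cases hv : v ∈ T
    · simp only [hf, hE, hu, hv, if_true, mul_add, Finset.sum_add_distrib]
      exact add_le_add (hcs (F u + F v) (F u)) (hcs (F u + F v) (F v))
    · simp [hf, hE, hu, hv, hnsq, ← sq]
    · simp [hf, hE, hu, hv, hnsq, ← sq]
    · simp [hf, hE, hu, hv]
  have hdeg : ∀ u, 0 ≤ G.deg u := fun u => Finset.sum_nonneg fun v _ => G.weight_nonneg u v
  obtain ⟨j, hj, hjle⟩ : ∃ j, 0 < ∑ u, G.deg u * f j u ^ 2 ∧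
      (∑ u, ∑ v, G.weight u v * (|f j u + f j v| * (|f j u| + |f j v|))) * m ≤
        (∑ u, ∑ v, G.weight u v * E u v) * ∑ u, G.deg u * f j u ^ 2 := by
    by_contra! h
    have hK0 : ∀ j, 0 ≤ ∑ u, G.deg u * f j u ^ 2 := fun j =>
      Finset.sum_nonneg fun u _ => mul_nonneg (hdeg u) (sq_nonneg _)
    have hle : ∀ j, (∑ u, ∑ v, G.weight u v * E u v) * ∑ u, G.deg u * f j u ^ 2 ≤
        (∑ u, ∑ v, G.weight u v * (|f j u + f j v| * (|f j u| + |f j v|))) * m := fun j => by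
      rcases (hK0 j).eq_or_lt with h0 | h0
      · rw [← h0, mul_zero]
        exact mul_nonneg (Finset.sum_nonneg fun u _ => Finset.sum_nonneg fun v _ =>
          mul_nonneg (G.weight_nonneg u v) (by positivity)) hT.le
      · exact (h j h0).le
    obtain ⟨j, -, hj⟩ : ∃ j ∈ Finset.univ, 0 < ∑ u, G.deg u * f j u ^ 2 :=
      (Finset.sum_pos_iff_of_nonneg fun j _ => hK0 j).mp (hmass.symm ▸ hT)
    have := Finset.sum_lt_sum (s := Finset.univ) (fun j _ => hle j) ⟨j, Finset.mem_univ _, h j hj⟩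
    rw [← Finset.mul_sum, ← Finset.sum_mul, hmass] at this
    exact absurd (lt_of_mul_lt_mul_right this hT.le) hcost.not_gt
  obtain ⟨S, S', h1, h2, h3, h4⟩ := G.exists_sweep (f j) hj
  refine ⟨S, S', h1, h2, fun u hu => ?_, ?_⟩
  · by_contra hT'
    exact h3 u hu (by simp [hf, hT'])
  · refine le_of_mul_le_mul_right ?_ hj
    nlinarith [mul_le_mul_of_nonneg_right h4 hT.le]

/-! ### Spectral embedding -/

theorem exists_spectral_embedding [DecidableEq V] (hd : ∀ u, 0 < G.deg u) {k : ℕ}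
    (hkn : k ≤ Fintype.card V) {j₀ : Fin (Fintype.card V)} (hj₀ : (j₀ : ℕ) = Fintype.card V - k) :
    ∃ F : V → EuclideanSpace ℝ (Fin k),
      (∀ i j, ∑ u, G.deg u * (F u i * F u j) = if i = j then 1 else 0) ∧
      ∑ u, ∑ v, G.weight u v * ‖F u + F v‖ ^ 2 ≤
        2 * k * (2 - G.eigenvalue j₀) := by
  set hL := G.isHermitian_normalizedLaplacian
  -- `eigenvalues₀` is nonincreasing, so its first k indices carry the k largest eigenvalues.
  set ι : Fin k → V := fun i =>
    Fintype.equivOfCardEq (Fintype.card_fin (Fintype.card V)) (Fin.castLE hkn i) with hι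
  have hιinj : Function.Injective ι := (Equiv.injective _).comp (Fin.castLE_injective hkn)
  set e : Fin k → V → ℝ := fun i u => hL.eigenvectorBasis (ι i) u with he
  have horth : ∀ i j, ∑ u, e i u * e j u = if i = j then 1 else 0 := fun i j => by
    have h := orthonormal_iff_ite.mp hL.eigenvectorBasis.orthonormal (ι i) (ι j)
    simp only [PiLp.inner_apply, RCLike.inner_apply, conj_trivial, hιinj.eq_iff] at h
    rw [← h]
    exact Finset.sum_congr rfl fun u _ => by simp only [he]; ring
  have heig : ∀ i, G.eigenvalue j₀ ≤ hL.eigenvalues (ι i) := fun i => by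
    rw [eigenvalue, Matrix.IsHermitian.eigenvalues]
    refine hL.eigenvalues₀_antitone ?_
    simp only [hι, Equiv.symm_apply_apply]
    rw [Fin.le_def, Fin.val_rev]
    simp only [Fin.val_castLE]
    omega
  have hs : ∀ u, 0 < √(G.deg u) := fun u => Real.sqrt_pos.mpr (hd u)
  have hss : ∀ u, √(G.deg u) * √(G.deg u) = G.deg u := fun u => Real.mul_self_sqrt (hd u).le
  have hmv : ∀ i u, e i u - ∑ v, (√(G.deg u))⁻¹ * G.weight u v * (√(G.deg v))⁻¹ * e i v =
      hL.eigenvalues (ι i) * e i u := fun i u => by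
    have h : G.normalizedLaplacian.mulVec (e i) u = hL.eigenvalues (ι i) * e i u :=
      congrFun (hL.mulVec_eigenvectorBasis (ι i)) u
    rw [← h]
    simp only [Matrix.mulVec, dotProduct, normalizedLaplacian, degInvSqrt, Matrix.mul_diagonal,
      Matrix.diagonal_mul, Matrix.sub_apply, adjacency, Matrix.of_apply, mul_sub, sub_mul,
      Finset.sum_sub_distrib, Matrix.diagonal_apply, ite_mul, zero_mul,
      Finset.sum_ite_eq, Finset.mem_univ, if_true]
    congr 1
    have := (hs u).ne'
    field_simp
    rw [sq, hss]
  refine ⟨fun u => WithLp.toLp 2 fun i => (√(G.deg u))⁻¹ * e i u, fun i j => ?_, ?_⟩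
  · rw [← horth]
    refine Finset.sum_congr rfl fun u _ => ?_
    have := (hs u).ne'
    field_simp
    rw [sq, hss]
  · have hquad : ∀ i, ∑ u, ∑ v, G.weight u v *
        ((√(G.deg u))⁻¹ * e i u + (√(G.deg v))⁻¹ * e i v) ^ 2 =
          2 * (2 - hL.eigenvalues (ι i)) := fun i => by
      have hsym : ∑ u, ∑ v, G.weight u v * ((√(G.deg v))⁻¹ * e i v) ^ 2 =
          ∑ u, ∑ v, G.weight u v * ((√(G.deg u))⁻¹ * e i u) ^ 2 := by
        rw [Finset.sum_comm]
        exact Finset.sum_congr rfl fun u _ => Finset.sum_congr rfl fun v _ => by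
          rw [G.weight_symm]
      have hone : ∑ u, ∑ v, G.weight u v * ((√(G.deg u))⁻¹ * e i u) ^ 2 = 1 := by
        have h1 := horth i i
        rw [if_pos rfl] at h1
        rw [← h1]
        refine Finset.sum_congr rfl fun u _ => ?_
        rw [← Finset.sum_mul]
        change G.deg u * _ = _
        have := (hs u).ne'
        field_simp
        rw [Real.sq_sqrt (hd u).le]
      have hcross : ∑ u, ∑ v, G.weight u v *
          (((√(G.deg u))⁻¹ * e i u) * ((√(G.deg v))⁻¹ * e i v)) =
            1 - hL.eigenvalues (ι i) := by
        have h1 := horth i i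
        rw [if_pos rfl] at h1
        have h2 : ∑ u, e i u * (hL.eigenvalues (ι i) * e i u) = hL.eigenvalues (ι i) := by
          rw [Finset.sum_congr rfl fun u _ => mul_left_comm (e i u) _ (e i u), ← Finset.mul_sum,
            h1, mul_one]
        simp only [← hmv, mul_sub, Finset.sum_sub_distrib, h1] at h2
        rw [← h2, sub_sub_cancel]
        refine Finset.sum_congr rfl fun u _ => ?_
        rw [Finset.mul_sum]
        exact Finset.sum_congr rfl fun v _ => by ring
      have hexp : ∀ u v, G.weight u v *
          ((√(G.deg u))⁻¹ * e i u + (√(G.deg v))⁻¹ * e i v) ^ 2 =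
          G.weight u v * ((√(G.deg u))⁻¹ * e i u) ^ 2 +
          G.weight u v * ((√(G.deg v))⁻¹ * e i v) ^ 2 + 2 * (G.weight u v *
          (((√(G.deg u))⁻¹ * e i u) * ((√(G.deg v))⁻¹ * e i v))) := fun u v => by ring
      simp only [hexp, Finset.sum_add_distrib, ← Finset.mul_sum, hsym, hone, hcross]
      ring
    have hnsq : ∀ x : EuclideanSpace ℝ (Fin k), ‖x‖ ^ 2 = ∑ j, x j ^ 2 := fun x => by
      simp [EuclideanSpace.norm_sq_eq]
    calc _ = ∑ i, ∑ u, ∑ v, G.weight u v *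
        ((√(G.deg u))⁻¹ * e i u + (√(G.deg v))⁻¹ * e i v) ^ 2 := by
          symm
          rw [Finset.sum_comm]
          refine Finset.sum_congr rfl fun u _ => ?_
          rw [Finset.sum_comm]
          refine Finset.sum_congr rfl fun v _ => ?_
          rw [hnsq, Finset.mul_sum]
          rfl
      _ ≤ ∑ i : Fin k, 2 * (2 - G.eigenvalue j₀) :=
          Finset.sum_le_sum fun i _ => by rw [hquad]; linarith [heig i]
      _ = _ := by
          rw [Finset.sum_const, Finset.card_univ, Fintype.card_fin, nsmul_eq_mul]; ring

end WeightedGraph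

/-! ### Partitions meeting two budgets at once -/

theorem exists_partition_of_sets_of_le {V X : Type*} [Fintype V] [DecidableEq V]
    [MeasurableSpace X] {ν : Measure X}
    {A : V → Set X} (hA : ∀ v, MeasurableSet (A v)) (hν : ∀ v, ν.real (A v) = 1)
    {a b : V → V → ℝ} (ha : ∀ u v, 0 ≤ a u v) (hb : ∀ u v, 0 ≤ b u v) {y x : ℝ} (hy : 0 < y)
    (hay : ∑ u, ∑ v, a u v * ν.real (A u ∩ A v) ≤ y)
    (hbx : ∑ u, ∑ v, b u v * ν.real (symmDiff (A u) (A v)) ≤ x) :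
    ∃ p : V → V, ∑ u, ∑ v, (if p u = p v then a u v else 0) ≤ 2 * y ∧
      ∑ u, ∑ v, (if p u = p v then 0 else b u v) ≤ 2 * x := by
  have hx : 0 ≤ x := le_trans (Finset.sum_nonneg fun u _ => Finset.sum_nonneg fun v _ =>
    mul_nonneg (hb u v) measureReal_nonneg) hbx
  have key : ∀ ε > 0, ∃ p : V → V, ∑ u, ∑ v, (if p u = p v then a u v else 0) ≤ 2 * y ∧
      ∑ u, ∑ v, (if p u = p v then 0 else b u v) ≤ 2 * x + ε := fun ε hε => by
    -- This multiplier equalizes the two budgets: the combined cost is at most y + Mx, hence at most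
    -- 2y, and division by M gives 2x + ε. The ε keeps the denominator positive when x = 0.
    set M := y / (x + ε) with hM
    have hxε : 0 < x + ε := by linarith
    have hM0 : 0 < M := div_pos hy hxε
    have hMy : M * (x + ε) = y := div_mul_cancel₀ y hxε.ne'
    obtain ⟨p, -, hp⟩ := exists_partition_of_sets hA hν ha (b := fun u v => M * b u v)
      (fun u v => mul_nonneg hM0.le (hb u v)) Finset.univ
    have e1 : ∀ u v, (if p u = p v then a u v else M * b u v) =
        (if p u = p v then a u v else 0) + M * (if p u = p v then 0 else b u v) := fun u v => by
      split_ifs <;> simp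
    have e2 : ∑ u, ∑ v, (if p u = p v then a u v else M * b u v) =
        ∑ u, ∑ v, (if p u = p v then a u v else 0) +
          M * ∑ u, ∑ v, (if p u = p v then 0 else b u v) := by
      simp only [e1, Finset.sum_add_distrib, ← Finset.mul_sum]
    simp only [mul_assoc, Finset.sum_add_distrib, ← Finset.mul_sum] at hp
    have h1 : 0 ≤ ∑ u, ∑ v, (if p u = p v then a u v else 0) :=
      Finset.sum_nonneg fun u _ => Finset.sum_nonneg fun v _ => by
        split_ifs
        exacts [ha u v, le_rfl]
    have h2 : 0 ≤ ∑ u, ∑ v, (if p u = p v then 0 else b u v) :=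
      Finset.sum_nonneg fun u _ => Finset.sum_nonneg fun v _ => by
        split_ifs
        exacts [le_rfl, hb u v]
    have h3 : ∑ u, ∑ v, (if p u = p v then a u v else 0) +
          M * ∑ u, ∑ v, (if p u = p v then 0 else b u v) ≤ y + M * x := by
      rw [← e2]
      refine le_trans (le_of_eq ?_) (hp.trans (add_le_add hay
        (mul_le_mul_of_nonneg_left hbx hM0.le)))
      exact Finset.sum_congr rfl fun u _ => Finset.sum_congr rfl fun v _ => by congr
    refine ⟨p, by nlinarith, le_of_mul_le_mul_left ?_ hM0⟩
    linarith
  -- There are finitely many `p`, so a minimizer of the cut cost removes ε.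
  set s : Set (V → V) := {p | ∑ u, ∑ v, (if p u = p v then a u v else 0) ≤ 2 * y} with hs
  obtain ⟨p₀, hp₀, -⟩ := key 1 one_pos
  obtain ⟨p, hps, hp⟩ := Set.exists_min_image s
    (fun p : V → V => ∑ u, ∑ v, (if p u = p v then 0 else b u v)) s.toFinite ⟨p₀, hp₀⟩
  refine ⟨p, hps, le_of_forall_pos_le_add fun ε hε => ?_⟩
  obtain ⟨p', h1, h2⟩ := key ε hε
  exact (hp p' h1).trans h2

/-! ### Clustering in projective space -/

/-- The point of the projective space given by a vector, as a rank one projection (zero for the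
zero vector). -/
noncomputable def rankOne {k : ℕ} (x : EuclideanSpace ℝ (Fin k)) :
    EuclideanSpace ℝ (Fin k × Fin k) :=
  WithLp.toLp 2 fun ij => x ij.1 * x ij.2 / ‖x‖ ^ 2

theorem inner_rankOne {k : ℕ} (x y : EuclideanSpace ℝ (Fin k)) :
    inner ℝ (rankOne x) (rankOne y) = inner ℝ x y ^ 2 / (‖x‖ ^ 2 * ‖y‖ ^ 2) := by
  simp only [PiLp.inner_apply, RCLike.inner_apply, conj_trivial, rankOne]
  rw [sq (∑ i, _), Finset.sum_mul_sum, Fintype.sum_prod_type, Finset.sum_div]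
  refine Finset.sum_congr rfl fun i _ => ?_
  rw [Finset.sum_div]
  exact Finset.sum_congr rfl fun j _ => by
    rw [div_mul_div_comm, mul_comm (‖y‖ ^ 2)]
    congr 1
    ring

theorem norm_rankOne_sq {k : ℕ} {x : EuclideanSpace ℝ (Fin k)} (hx : x ≠ 0) :
    ‖rankOne x‖ ^ 2 = 1 := by
  have : ‖x‖ ≠ 0 := norm_ne_zero_iff.mpr hx
  rw [← real_inner_self_eq_norm_sq, inner_rankOne, real_inner_self_eq_norm_sq]
  field_simp

theorem rankOne_zero {k : ℕ} : rankOne (0 : EuclideanSpace ℝ (Fin k)) = 0 := by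
  ext
  simp [rankOne]

theorem norm_sq_mul_norm_rankOne_sub_sq {k : ℕ} (x y : EuclideanSpace ℝ (Fin k)) :
    ‖x‖ ^ 2 * ‖y‖ ^ 2 * ‖rankOne x - rankOne y‖ ^ 2 =
      2 * (‖x‖ ^ 2 * ‖y‖ ^ 2 - inner ℝ x y ^ 2) := by
  rcases eq_or_ne x 0 with rfl | hx
  · simp
  rcases eq_or_ne y 0 with rfl | hy
  · simp
  have h1 : ‖x‖ ≠ 0 := norm_ne_zero_iff.mpr hx
  have h2 : ‖y‖ ≠ 0 := norm_ne_zero_iff.mpr hy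
  rw [norm_sub_sq_real, norm_rankOne_sq hx, norm_rankOne_sq hy, inner_rankOne]
  field_simp
  ring

/-- For nonzero vectors the left side is √2 times the distance from x to the line through y, and -y
lies on that line. -/
theorem norm_rankOne_sub_mul_le {k : ℕ} (x y : EuclideanSpace ℝ (Fin k)) :
    ‖rankOne x - rankOne y‖ * ‖x‖ ≤ √2 * ‖x + y‖ := by
  refine abs_le_of_sq_le_sq' ?_ (by positivity) |>.2
  rw [mul_pow, mul_pow, Real.sq_sqrt zero_le_two]
  rcases eq_or_ne x 0 with rfl | hx
  · simp
  rcases eq_or_ne y 0 with rfl | hy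
  · rw [rankOne_zero, sub_zero, add_zero, norm_rankOne_sq hx]
    nlinarith [sq_nonneg ‖x‖]
  have h2 : 0 < ‖y‖ ^ 2 := pow_pos (norm_pos_iff.mpr hy) 2
  refine le_of_mul_le_mul_left ?_ h2
  have := norm_sq_mul_norm_rankOne_sub_sq x y
  rw [norm_add_sq_real]
  nlinarith [sq_nonneg (‖y‖ ^ 2 + inner ℝ x y)]

namespace WeightedGraph

variable {V : Type*} [Fintype V] (G : WeightedGraph V)

/-- The cost of the edges for a vector valued function. -/
noncomputable def edgeCost {k : ℕ} (F : V → EuclideanSpace ℝ (Fin k)) : ℝ :=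
  ∑ u, ∑ v, G.weight u v * (‖F u + F v‖ * (‖F u‖ + ‖F v‖))

/-- Gaussian regions are attached to the lines of the F(u). Separating u and v costs ‖F(u)‖² +
‖F(v)‖², and the separation measure, at most 3s times the distance of the lines, absorbs one factor
of each norm. -/
theorem exists_partition [DecidableEq V] {k : ℕ} (F : V → EuclideanSpace ℝ (Fin k))
    (hd : ∀ u, 0 ≤ G.deg u)
    {s y : ℝ} (hs : 0 < s) (hy : 0 < y)
    (h : ∑ u, ∑ v, G.deg u * G.deg v * (‖F u‖ ^ 2 * ‖F v‖ ^ 2 - inner ℝ (F u) (F v) ^ 2) *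
      Real.exp (-(s ^ 2 * ‖rankOne (F u) - rankOne (F v)‖ ^ 2)) ≤ y) :
    ∃ p : V → V, ∑ u, ∑ v, (if p u = p v then
        G.deg u * G.deg v * (‖F u‖ ^ 2 * ‖F v‖ ^ 2 - inner ℝ (F u) (F v) ^ 2) else 0) ≤ 2 * y ∧
      ∑ u, ∑ v, (if p u = p v then 0 else G.weight u v * (‖F u‖ ^ 2 + ‖F v‖ ^ 2)) ≤
        2 * (5 * s * G.edgeCost F) := by
  obtain ⟨A, hA, hA1, hA2, hA3⟩ :=
    exists_gaussian_sets (E := EuclideanSpace ℝ (Fin k × Fin k)) hs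
  have ha : ∀ u v, 0 ≤ G.deg u * G.deg v *
      (‖F u‖ ^ 2 * ‖F v‖ ^ 2 - inner ℝ (F u) (F v) ^ 2) := fun u v => by
    refine mul_nonneg (mul_nonneg (hd u) (hd v)) (sub_nonneg.mpr ?_)
    rw [← mul_pow]
    exact sq_le_sq' (neg_le_of_abs_le (abs_real_inner_le_norm _ _)) (real_inner_le_norm _ _)
  refine exists_partition_of_sets_of_le (A := fun u => A (rankOne (F u))) (fun u => hA _)
    (fun u => hA1 _) ha (fun u v => mul_nonneg (G.weight_nonneg u v) (by positivity)) hy ?_ ?_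
  · exact le_trans (Finset.sum_le_sum fun u _ => Finset.sum_le_sum fun v _ =>
      mul_le_mul_of_nonneg_left (hA2 _ _) (ha u v)) h
  · rw [edgeCost, Finset.mul_sum]
    refine Finset.sum_le_sum fun u _ => ?_
    rw [Finset.mul_sum]
    refine Finset.sum_le_sum fun v _ => ?_
    have h2 : √2 * 3 ≤ 5 := by
      nlinarith [Real.sq_sqrt zero_le_two, Real.sqrt_nonneg 2, sq_nonneg (√2 * 3 - 5)]
    have hu := norm_rankOne_sub_mul_le (F u) (F v)
    have hv := norm_rankOne_sub_mul_le (F v) (F u)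
    rw [norm_sub_rev, add_comm] at hv
    set D := ‖rankOne (F u) - rankOne (F v)‖
    set N := ‖F u + F v‖ with hN
    have hN0 : 0 ≤ N := norm_nonneg _
    have h3 : (‖F u‖ ^ 2 + ‖F v‖ ^ 2) * (3 * s * D) ≤ 5 * s * (N * (‖F u‖ + ‖F v‖)) := by
      have e1 : D * ‖F u‖ * ‖F u‖ ≤ √2 * N * ‖F u‖ :=
        mul_le_mul_of_nonneg_right hu (norm_nonneg _)
      have e2 : D * ‖F v‖ * ‖F v‖ ≤ √2 * N * ‖F v‖ :=
        mul_le_mul_of_nonneg_right hv (norm_nonneg _)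
      have e3 : √2 * 3 * (N * (‖F u‖ + ‖F v‖)) ≤ 5 * (N * (‖F u‖ + ‖F v‖)) :=
        mul_le_mul_of_nonneg_right h2 (by positivity)
      have e4 : (‖F u‖ ^ 2 + ‖F v‖ ^ 2) * (3 * D) ≤ 5 * (N * (‖F u‖ + ‖F v‖)) := by linarith
      nlinarith [mul_le_mul_of_nonneg_left e4 hs.le]
    have h4 := mul_le_mul_of_nonneg_left ((mul_le_mul_of_nonneg_left
      (hA3 (rankOne (F u)) (rankOne (F v))) (by positivity)).trans h3) (G.weight_nonneg u v)
    linarith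

end WeightedGraph

/-! ### From a partition to communities -/

theorem Finset.sum_ite_mem_le_of_pairwiseDisjoint {ι : Type*} [DecidableEq ι]
    {𝒬 : Finset (Finset ι)} (h : (𝒬 : Set (Finset ι)).PairwiseDisjoint id) (x : ι) {c : ℝ}
    (hc : 0 ≤ c) : ∑ Q ∈ 𝒬, (if x ∈ Q then c else 0) ≤ c := by
  by_cases hx : ∃ Q ∈ 𝒬, x ∈ Q
  · obtain ⟨Q, hQ, hxQ⟩ := hx
    have h0 : ∀ Q' ∈ 𝒬, Q' ≠ Q → (if x ∈ Q' then c else 0) = 0 := fun Q' hQ' hne =>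
      if_neg fun hxQ' => Finset.disjoint_left.mp (h hQ' hQ hne) hxQ' hxQ
    rw [Finset.sum_eq_single_of_mem Q hQ h0, if_pos hxQ]
  · push Not at hx
    rw [Finset.sum_eq_zero fun Q hQ => if_neg (hx Q hQ)]
    exact hc

namespace WeightedGraph

variable {V : Type*} [Fintype V] (G : WeightedGraph V)

theorem sum_deg_mul_norm_sq {k : ℕ} {F : V → EuclideanSpace ℝ (Fin k)}
    (hF : ∀ i j, ∑ u, G.deg u * (F u i * F u j) = if i = j then 1 else 0) :
    ∑ u, G.deg u * ‖F u‖ ^ 2 = k := by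
  have h : ∀ u, G.deg u * ‖F u‖ ^ 2 = ∑ i, G.deg u * (F u i * F u i) := fun u => by
    rw [EuclideanSpace.norm_sq_eq, Finset.mul_sum]
    exact Finset.sum_congr rfl fun i _ => by rw [Real.norm_eq_abs, sq_abs, sq]
  simp only [h]
  rw [Finset.sum_comm]
  simp [hF]

/-- The sum is the trace of the square of ∑ d(u) F(u)F(u)ᵀ, the identity of size k. -/
theorem sum_deg_mul_inner_sq {k : ℕ} {F : V → EuclideanSpace ℝ (Fin k)}
    (hF : ∀ i j, ∑ u, G.deg u * (F u i * F u j) = if i = j then 1 else 0) :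
    ∑ u, ∑ v, G.deg u * G.deg v * inner ℝ (F u) (F v) ^ 2 = k := by
  have h : ∀ u v, G.deg u * G.deg v * inner ℝ (F u) (F v) ^ 2 =
      ∑ i, ∑ j, (G.deg u * (F u i * F u j)) * (G.deg v * (F v i * F v j)) := fun u v => by
    simp only [PiLp.inner_apply, RCLike.inner_apply, conj_trivial]
    rw [sq, Finset.sum_mul_sum, Finset.mul_sum]
    refine Finset.sum_congr rfl fun i _ => ?_
    rw [Finset.mul_sum]
    exact Finset.sum_congr rfl fun j _ => by ring
  calc _ = ∑ i : Fin k, ∑ j : Fin k, (∑ u, G.deg u * (F u i * F u j)) *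
        ∑ v, G.deg v * (F v i * F v j) := by
          simp only [h, Finset.sum_mul_sum]
          rw [Finset.sum_congr rfl fun u _ => Finset.sum_comm, Finset.sum_comm]
          refine Finset.sum_congr rfl fun i _ => ?_
          rw [Finset.sum_congr rfl fun u _ => Finset.sum_comm, Finset.sum_comm]
    _ = k := by simp [hF]

/-- Cauchy-Schwarz over ordered pairs: √(2kμ) · √(4k) = √8 · k√μ. -/
theorem edgeCost_le {k : ℕ} {F : V → EuclideanSpace ℝ (Fin k)}
    (hF : ∀ i j, ∑ u, G.deg u * (F u i * F u j) = if i = j then 1 else 0) {μ : ℝ}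
    (hμ : ∑ u, ∑ v, G.weight u v * ‖F u + F v‖ ^ 2 ≤ 2 * k * μ) :
    G.edgeCost F ≤ 3 * k * √μ := by
  have hw := G.weight_nonneg
  have h1 : G.edgeCost F = ∑ e : V × V, (√(G.weight e.1 e.2) * ‖F e.1 + F e.2‖) *
      (√(G.weight e.1 e.2) * (‖F e.1‖ + ‖F e.2‖)) := by
    rw [edgeCost, Fintype.sum_prod_type]
    refine Finset.sum_congr rfl fun u _ => Finset.sum_congr rfl fun v _ => ?_
    rw [mul_mul_mul_comm, Real.mul_self_sqrt (hw u v)]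
  have h2 : ∑ e : V × V, (√(G.weight e.1 e.2) * ‖F e.1 + F e.2‖) ^ 2 ≤ 2 * k * μ := by
    rw [Fintype.sum_prod_type]
    refine le_of_eq_of_le (Finset.sum_congr rfl fun u _ => Finset.sum_congr rfl fun v _ => ?_) hμ
    rw [mul_pow, Real.sq_sqrt (hw u v)]
  have h3 : ∑ e : V × V, (√(G.weight e.1 e.2) * (‖F e.1‖ + ‖F e.2‖)) ^ 2 ≤ 4 * k := by
    rw [Fintype.sum_prod_type]
    have e1 : ∑ u, ∑ v, G.weight u v * ‖F u‖ ^ 2 = k := by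
      rw [← G.sum_deg_mul_norm_sq hF]
      exact Finset.sum_congr rfl fun u _ => by rw [← Finset.sum_mul]; rfl
    have e2 : ∑ u, ∑ v, G.weight u v * ‖F v‖ ^ 2 = k := by
      rw [← e1, Finset.sum_comm]
      exact Finset.sum_congr rfl fun u _ => Finset.sum_congr rfl fun v _ => by rw [G.weight_symm]
    calc ∑ u, ∑ v, (√(G.weight u v) * (‖F u‖ + ‖F v‖)) ^ 2
        ≤ ∑ u, ∑ v, (2 * (G.weight u v * ‖F u‖ ^ 2) + 2 * (G.weight u v * ‖F v‖ ^ 2)) := by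
          refine Finset.sum_le_sum fun u _ => Finset.sum_le_sum fun v _ => ?_
          rw [mul_pow, Real.sq_sqrt (hw u v)]
          nlinarith [mul_nonneg (hw u v) (sq_nonneg (‖F u‖ - ‖F v‖))]
      _ = 4 * (k : ℝ) := by
          simp only [Finset.sum_add_distrib, ← Finset.mul_sum, e1, e2]; ring
  rw [h1]
  refine (Real.sum_mul_le_sqrt_mul_sqrt _ _ _).trans ?_
  calc _ ≤ √(2 * k * μ) * √(4 * k) :=
        mul_le_mul (Real.sqrt_le_sqrt h2) (Real.sqrt_le_sqrt h3) (Real.sqrt_nonneg _)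
          (Real.sqrt_nonneg _)
    _ = √8 * (k * √μ) := by
        rw [← Real.sqrt_mul' _ (by positivity), show 2 * k * μ * (4 * k) = 8 * ((k : ℝ) ^ 2 * μ) by
          ring, Real.sqrt_mul (by norm_num), Real.sqrt_mul (by positivity),
          Real.sqrt_sq (by positivity)]
    _ ≤ 3 * (k * √μ) := by
        refine mul_le_mul_of_nonneg_right ?_ (by positivity)
        rw [Real.sqrt_le_left (by norm_num)]
        norm_num
    _ = _ := by ring

theorem exists_communities [DecidableEq V] {k : ℕ} {F : V → EuclideanSpace ℝ (Fin k)}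
    (hd : ∀ u, 0 ≤ G.deg u)
    (hF : ∀ i j, ∑ u, G.deg u * (F u i * F u j) = if i = j then 1 else 0)
    {s y : ℝ} (hs : 0 < s) (hy : 0 < y)
    (h : ∑ u, ∑ v, G.deg u * G.deg v * (‖F u‖ ^ 2 * ‖F v‖ ^ 2 - inner ℝ (F u) (F v) ^ 2) *
      Real.exp (-(s ^ 2 * ‖rankOne (F u) - rankOne (F v)‖ ^ 2)) ≤ y) :
    ∃ N : ℕ, k - 2 * y < N + 1 / 2 ∧ ∃ S S' : Fin N → Finset V, IsCommunityFamily S S' ∧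
      ∀ i, ((N : ℝ) - i) * G.bipartiteConductance (S i) (S' i) ≤
        4 * (1 + 10 * s) * G.edgeCost F := by
  obtain ⟨p, hpa, hpb⟩ := G.exists_partition F hd hs hy h
  set m : V → ℝ := fun x => ∑ u with p u = x, G.deg u * ‖F u‖ ^ 2 with hm
  obtain ⟨𝒬, hdisj, hQ, hcard⟩ := exists_groups m Finset.univ
  have hm1 : ∑ x, m x = k := by
    rw [← G.sum_deg_mul_norm_sq hF]
    exact Finset.sum_fiberwise _ _ _
  -- Within a class, ‖F(u)‖²‖F(v)‖² splits into the non-parallel part, at most 2y in total by the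
  -- choice of `p`, and ⟨F(u), F(v)⟩², which sums to k over all pairs.
  have hm2 : ∑ x, m x ^ 2 ≤ k + 2 * y := by
    have e1 : ∑ x, m x ^ 2 = ∑ u, ∑ v, if p u = p v then
        (G.deg u * ‖F u‖ ^ 2) * (G.deg v * ‖F v‖ ^ 2) else 0 := by
      have e0 : ∀ x, m x ^ 2 = ∑ u with p u = x, (G.deg u * ‖F u‖ ^ 2) * m (p u) := fun x => by
        have e : ∀ u ∈ Finset.univ.filter (p · = x), (G.deg u * ‖F u‖ ^ 2) * m (p u) =
            (G.deg u * ‖F u‖ ^ 2) * m x := fun u hu => by rw [(Finset.mem_filter.mp hu).2]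
        rw [sq, Finset.sum_congr rfl e, ← Finset.sum_mul]
      simp only [e0]
      rw [Finset.sum_fiberwise]
      refine Finset.sum_congr rfl fun u _ => ?_
      simp only [hm]
      rw [Finset.sum_filter, Finset.mul_sum]
      exact Finset.sum_congr rfl fun v _ => by rw [mul_ite, mul_zero]; simp only [eq_comm]
    have e2 : ∀ u v, (if p u = p v then (G.deg u * ‖F u‖ ^ 2) * (G.deg v * ‖F v‖ ^ 2) else 0) ≤
        (if p u = p v then
          G.deg u * G.deg v * (‖F u‖ ^ 2 * ‖F v‖ ^ 2 - inner ℝ (F u) (F v) ^ 2) else 0) +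
          G.deg u * G.deg v * inner ℝ (F u) (F v) ^ 2 := fun u v => by
      have := mul_nonneg (mul_nonneg (hd u) (hd v)) (sq_nonneg (inner ℝ (F u) (F v)))
      split_ifs <;> linarith
    rw [e1]
    refine (Finset.sum_le_sum fun u _ => Finset.sum_le_sum fun v _ => e2 u v).trans ?_
    simp only [Finset.sum_add_distrib, G.sum_deg_mul_inner_sq hF]
    linarith
  set T : Finset V → Finset V := fun Q => {u | p u ∈ Q} with hT
  have hmemT : ∀ u Q, u ∈ T Q ↔ p u ∈ Q := fun u Q => by simp [hT]
  have hmassT : ∀ Q, ∑ u ∈ T Q, G.deg u * ‖F u‖ ^ 2 = ∑ x ∈ Q, m x := fun Q => by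
    rw [← Finset.sum_fiberwise_of_maps_to (t := Q) fun u hu => (hmemT u Q).mp hu]
    refine Finset.sum_congr rfl fun x hx => Finset.sum_congr ?_ fun _ _ => rfl
    ext u
    simp only [Finset.mem_filter, hmemT, Finset.mem_univ, true_and, and_iff_right_iff_imp]
    rintro rfl
    exact hx
  have hex : ∀ Q, ∃ S S' : Finset V, Q ∈ 𝒬 → (Disjoint S S' ∧ (S ∪ S').Nonempty ∧ S ∪ S' ⊆ T Q ∧
      G.bipartiteConductance S S' * ∑ u ∈ T Q, G.deg u * ‖F u‖ ^ 2 ≤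
        ∑ u, ∑ v, G.weight u v * (if u ∈ T Q then
          if v ∈ T Q then ‖F u + F v‖ * (‖F u‖ + ‖F v‖) else ‖F u‖ ^ 2
          else if v ∈ T Q then ‖F v‖ ^ 2 else 0)) := fun Q => by
    by_cases hQm : Q ∈ 𝒬
    · obtain ⟨S, S', h⟩ := G.exists_sweep_of_vector F (T Q) (by
        rw [hmassT]; linarith [(hQ Q hQm).2])
      exact ⟨S, S', fun _ => h⟩
    · exact ⟨∅, ∅, fun h => absurd h hQm⟩
  choose S S' hSS using hex
  have htotal : ∑ Q ∈ 𝒬, G.bipartiteConductance (S Q) (S' Q) ≤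
      4 * (1 + 10 * s) * G.edgeCost F := by
    -- The factor 4 comes from the mass of the group, which is at least 1/4.
    have e1 : ∀ Q ∈ 𝒬, G.bipartiteConductance (S Q) (S' Q) ≤
        4 * ∑ u, ∑ v, G.weight u v * (if u ∈ T Q then
          if v ∈ T Q then ‖F u + F v‖ * (‖F u‖ + ‖F v‖) else ‖F u‖ ^ 2
          else if v ∈ T Q then ‖F v‖ ^ 2 else 0) := fun Q hQm => by
      have h1 := (hSS Q hQm).2.2.2
      have h2 := (hQ Q hQm).2
      rw [hmassT] at h1
      nlinarith [G.bipartiteConductance_nonneg (S Q) (S' Q)]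
    -- The groups are disjoint unions of classes: an edge is internal to at most one group, and it
    -- leaves a group only if its ends lie in different classes.
    have e2 : ∀ u v, ∑ Q ∈ 𝒬, (if u ∈ T Q then
          if v ∈ T Q then ‖F u + F v‖ * (‖F u‖ + ‖F v‖) else ‖F u‖ ^ 2
          else if v ∈ T Q then ‖F v‖ ^ 2 else 0) ≤
        ‖F u + F v‖ * (‖F u‖ + ‖F v‖) + if p u = p v then 0 else ‖F u‖ ^ 2 + ‖F v‖ ^ 2 :=
      fun u v => by
        have h0 : 0 ≤ ‖F u + F v‖ * (‖F u‖ + ‖F v‖) := by positivity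
        have hu := sq_nonneg ‖F u‖
        have hv := sq_nonneg ‖F v‖
        have g0 := Finset.sum_ite_mem_le_of_pairwiseDisjoint hdisj (p u) h0
        simp only [hmemT]
        by_cases huv : p u = p v
        · rw [if_pos huv, add_zero]
          refine le_trans (Finset.sum_le_sum fun Q _ => ?_) g0
          rw [huv]
          split_ifs <;> linarith
        · rw [if_neg huv]
          have g1 := Finset.sum_ite_mem_le_of_pairwiseDisjoint hdisj (p u) hu
          have g2 := Finset.sum_ite_mem_le_of_pairwiseDisjoint hdisj (p v) hv
          refine le_trans ?_ (add_le_add g0 (add_le_add g1 g2))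
          simp only [← Finset.sum_add_distrib]
          refine Finset.sum_le_sum fun Q _ => ?_
          split_ifs <;> linarith
    refine (Finset.sum_le_sum e1).trans ?_
    rw [← Finset.mul_sum, Finset.sum_comm, mul_assoc]
    refine mul_le_mul_of_nonneg_left ?_ (by norm_num)
    calc _ ≤ ∑ u, ∑ v, (G.weight u v * (‖F u + F v‖ * (‖F u‖ + ‖F v‖)) +
          if p u = p v then 0 else G.weight u v * (‖F u‖ ^ 2 + ‖F v‖ ^ 2)) := by
          refine Finset.sum_le_sum fun u _ => ?_
          rw [Finset.sum_comm]
          refine Finset.sum_le_sum fun v _ => ?_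
          rw [← Finset.mul_sum]
          refine (mul_le_mul_of_nonneg_left (e2 u v) (G.weight_nonneg u v)).trans_eq ?_
          rw [mul_add, mul_ite, mul_zero]
      _ ≤ _ := by
          simp only [Finset.sum_add_distrib]
          change G.edgeCost F + _ ≤ _
          linarith
  obtain ⟨e, heinj, hemem, he⟩ := exists_enumeration_le 𝒬
    (fun Q _ => G.bipartiteConductance_nonneg (S Q) (S' Q)) htotal
  refine ⟨𝒬.card, ?_, fun i => S (e i), fun i => S' (e i), ⟨?_,
    fun i => (hSS _ (hemem i)).2.1⟩, he⟩
  · rw [Finset.sum_sub_distrib, ← Finset.mul_sum, hm1] at hcard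
    linarith
  · have hTd : ∀ i j, i ≠ j → Disjoint (T (e i)) (T (e j)) := fun i j hij => by
      rw [Finset.disjoint_left]
      intro u hu hv
      exact Finset.disjoint_left.mp (hdisj (hemem i) (hemem j) (heinj.ne hij))
        ((hmemT _ _).mp hu) ((hmemT _ _).mp hv)
    have h1 : ∀ i, S (e i) ⊆ T (e i) := fun i =>
      Finset.subset_union_left.trans (hSS _ (hemem i)).2.2.1
    have h2 : ∀ i, S' (e i) ⊆ T (e i) := fun i =>
      Finset.subset_union_right.trans (hSS _ (hemem i)).2.2.1
    have h3 : ∀ i, Disjoint (S (e i)) (S' (e i)) := fun i => (hSS _ (hemem i)).1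
    rintro (i | i) (j | j) hij
    · exact Disjoint.mono (h1 i) (h1 j) (hTd i j fun h => hij (congrArg _ h))
    · rcases eq_or_ne i j with rfl | hne
      · exact h3 i
      · exact Disjoint.mono (h1 i) (h2 j) (hTd i j hne)
    · rcases eq_or_ne i j with rfl | hne
      · exact (h3 i).symm
      · exact Disjoint.mono (h2 i) (h1 j) (hTd i j hne)
    · exact Disjoint.mono (h2 i) (h2 j) (hTd i j fun h => hij (congrArg _ h))

theorem IsCommunityFamily.castLE {V : Type*} [DecidableEq V] {N r : ℕ} (hr : r ≤ N)
    {S S' : Fin N → Finset V}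
    (h : IsCommunityFamily S S') :
    IsCommunityFamily (fun i : Fin r => S (Fin.castLE hr i)) fun i => S' (Fin.castLE hr i) := by
  refine ⟨?_, fun i => h.nonempty _⟩
  have hinj := Fin.castLE_injective hr
  rintro (i | i) (j | j) hij
  · exact h.disjoint (i := Sum.inl (Fin.castLE hr i)) (j := Sum.inl (Fin.castLE hr j))
      fun e => hij (congrArg _ (hinj (Sum.inl_injective e)))
  · exact h.disjoint (i := Sum.inl (Fin.castLE hr i)) (j := Sum.inr (Fin.castLE hr j)) (by simp)
  · exact h.disjoint (i := Sum.inr (Fin.castLE hr i)) (j := Sum.inl (Fin.castLE hr j)) (by simp)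
  · exact h.disjoint (i := Sum.inr (Fin.castLE hr i)) (j := Sum.inr (Fin.castLE hr j))
      fun e => hij (congrArg _ (hinj (Sum.inr_injective e)))

/-! ### The two choices of scale -/

theorem overlap_eq {k : ℕ} (F : V → EuclideanSpace ℝ (Fin k)) (u v : V) :
    G.deg u * G.deg v * (‖F u‖ ^ 2 * ‖F v‖ ^ 2 - inner ℝ (F u) (F v) ^ 2) =
      (G.deg u * ‖F u‖ ^ 2) * (G.deg v * ‖F v‖ ^ 2) *
        (‖rankOne (F u) - rankOne (F v)‖ ^ 2 / 2) := by
  have := norm_sq_mul_norm_rankOne_sub_sq (F u) (F v)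
  linear_combination (-(G.deg u * G.deg v) / 2) * this

theorem sum_mass_mul_mass {k : ℕ} {F : V → EuclideanSpace ℝ (Fin k)}
    (hF : ∀ i j, ∑ u, G.deg u * (F u i * F u j) = if i = j then 1 else 0) :
    ∑ u, ∑ v, (G.deg u * ‖F u‖ ^ 2) * (G.deg v * ‖F v‖ ^ 2) = (k : ℝ) ^ 2 := by
  rw [← Finset.sum_mul_sum, G.sum_deg_mul_norm_sq hF, sq]

theorem exists_communities_of_le [DecidableEq V] {k : ℕ} (hk : 1 ≤ k)
    {F : V → EuclideanSpace ℝ (Fin k)}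
    (hd : ∀ u, 0 ≤ G.deg u)
    (hF : ∀ i j, ∑ u, G.deg u * (F u i * F u j) = if i = j then 1 else 0) {μ : ℝ}
    (hμ : ∑ u, ∑ v, G.weight u v * ‖F u + F v‖ ^ 2 ≤ 2 * k * μ) :
    ∃ S S' : Fin k → Finset V, IsCommunityFamily S S' ∧
      ∀ i : Fin k, G.bipartiteConductance (S i) (S' i) ≤
        2000 * ((k : ℝ) ^ 2 / ((k : ℝ) + 1 - ((i : ℕ) + 1 : ℝ))) * √μ := by
  have hk0 : (1 : ℝ) ≤ k := by exact_mod_cast hk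
  have hexp : ∀ z : ℝ, z * Real.exp (-z) ≤ 1 := fun z => by
    rw [Real.exp_neg, ← div_eq_mul_inv, div_le_one (Real.exp_pos z)]
    linarith [Real.add_one_le_exp z]
  -- Applying z e^(-z) ≤ 1 to z = 4k²D², with D the distance of the lines, bounds D²/2 · e^(-z) by
  -- 1/(8k²); the masses sum to k², so the overlap is at most 1/8. With y = 1/4, k - 1/2 < N + 1/2
  -- forces N ≥ k.
  obtain ⟨N, hN, S, S', hS, hc⟩ := G.exists_communities hd hF (s := 2 * k) (y := 1 / 4)
    (by linarith) (by norm_num) (by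
      have h1 : ∀ u v, G.deg u * G.deg v * (‖F u‖ ^ 2 * ‖F v‖ ^ 2 - inner ℝ (F u) (F v) ^ 2) *
          Real.exp (-((2 * (k : ℝ)) ^ 2 * ‖rankOne (F u) - rankOne (F v)‖ ^ 2)) ≤
          ((G.deg u * ‖F u‖ ^ 2) * (G.deg v * ‖F v‖ ^ 2)) * (8 * (k : ℝ) ^ 2)⁻¹ := fun u v => by
        rw [overlap_eq, mul_assoc]
        refine mul_le_mul_of_nonneg_left ?_ (mul_nonneg (mul_nonneg (hd u) (by positivity))
          (mul_nonneg (hd v) (by positivity)))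
        rw [← one_div, le_div_iff₀ (by positivity)]
        refine le_of_eq_of_le ?_ (hexp ((2 * (k : ℝ)) ^ 2 * ‖rankOne (F u) - rankOne (F v)‖ ^ 2))
        ring
      refine (Finset.sum_le_sum fun u _ => Finset.sum_le_sum fun v _ => h1 u v).trans ?_
      simp only [← Finset.sum_mul]
      rw [G.sum_mass_mul_mass hF, ← div_eq_mul_inv, div_le_iff₀ (by positivity)]
      nlinarith)
  have hkN : k ≤ N := by
    have : (k : ℝ) < N + 1 := by linarith
    exact_mod_cast Nat.lt_succ_iff.mp (by exact_mod_cast this)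
  refine ⟨_, _, hS.castLE hkN, fun i => ?_⟩
  have h1 := hc (Fin.castLE hkN i)
  have hik : ((i : ℕ) : ℝ) + 1 ≤ k := by exact_mod_cast i.2
  have hkN' : (k : ℝ) ≤ N := by exact_mod_cast hkN
  rw [Fin.val_castLE] at h1
  set φ := G.bipartiteConductance (S (Fin.castLE hkN i)) (S' (Fin.castLE hkN i))
  have hφ : 0 ≤ φ := G.bipartiteConductance_nonneg _ _
  have hW := G.edgeCost_le hF hμ
  have hr := Real.sqrt_nonneg μ
  have hpos : (0 : ℝ) < (k : ℝ) + 1 - ((i : ℕ) + 1 : ℝ) := by linarith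
  rw [mul_div_assoc', div_mul_eq_mul_div, le_div_iff₀ hpos]
  calc φ * ((k : ℝ) + 1 - ((i : ℕ) + 1 : ℝ)) ≤ (N - (i : ℕ)) * φ := by nlinarith
    _ ≤ 4 * (1 + 10 * (2 * k)) * G.edgeCost F := h1
    _ ≤ 4 * (1 + 10 * (2 * k)) * (3 * k * √μ) := mul_le_mul_of_nonneg_left hW (by positivity)
    _ ≤ 4 * (21 * k) * (3 * k * √μ) :=
        mul_le_mul_of_nonneg_right (by linarith) (by positivity)
    _ ≤ 2000 * (k : ℝ) ^ 2 * √μ := by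
        have : 0 ≤ (k : ℝ) ^ 2 * √μ := by positivity
        nlinarith

theorem exists_communities_quarter [DecidableEq V] {k : ℕ} {F : V → EuclideanSpace ℝ (Fin k)}
    (hd : ∀ u, 0 ≤ G.deg u)
    (hF : ∀ i j, ∑ u, G.deg u * (F u i * F u j) = if i = j then 1 else 0) {μ : ℝ}
    (hμ : ∑ u, ∑ v, G.weight u v * ‖F u + F v‖ ^ 2 ≤ 2 * k * μ) :
    ∃ S S' : Fin (k / 4) → Finset V, IsCommunityFamily S S' ∧
      ∀ i : Fin (k / 4), G.bipartiteConductance (S i) (S' i) ≤ 2000 * √(Real.log k * μ) := by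
  rcases lt_or_ge k 4 with hk4 | hk4
  · have h0 : k / 4 = 0 := Nat.div_eq_of_lt hk4
    have hE : IsEmpty (Fin (k / 4)) := by rw [h0]; infer_instance
    refine ⟨fun _ => ∅, fun _ => ∅, ⟨?_, fun i => hE.elim i⟩, fun i => hE.elim i⟩
    rintro (i | i) <;> exact hE.elim i
  have hk0 : (4 : ℝ) ≤ k := by exact_mod_cast hk4
  have hlog : 1 ≤ Real.log k := by
    rw [Real.le_log_iff_exp_le (by linarith)]
    linarith [Real.exp_one_lt_d9]
  have hsl : 1 ≤ √(Real.log k) := Real.one_le_sqrt.mpr hlog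
  have hexp : Real.exp (-(4 * Real.log k)) = ((k : ℝ) ^ 4)⁻¹ := by
    rw [Real.exp_neg, ← Real.exp_log (show (0 : ℝ) < k by linarith), ← Real.exp_nat_mul,
      Real.log_exp]
    norm_num
  obtain ⟨N, hN, S, S', hS, hc⟩ := G.exists_communities hd hF (s := 4 * √(Real.log k))
    (y := k / 4) (by linarith) (by linarith) (by
      have h1 : ∀ u v, G.deg u * G.deg v * (‖F u‖ ^ 2 * ‖F v‖ ^ 2 - inner ℝ (F u) (F v) ^ 2) *
          Real.exp (-((4 * √(Real.log k)) ^ 2 * ‖rankOne (F u) - rankOne (F v)‖ ^ 2)) ≤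
          G.deg u * G.deg v * inner ℝ (F u) (F v) ^ 2 * 7⁻¹ +
          ((G.deg u * ‖F u‖ ^ 2) * (G.deg v * ‖F v‖ ^ 2)) * ((k : ℝ) ^ 4)⁻¹ := fun u v => by
        have hov := G.overlap_eq F u v
        have hm : 0 ≤ (G.deg u * ‖F u‖ ^ 2) * (G.deg v * ‖F v‖ ^ 2) :=
          mul_nonneg (mul_nonneg (hd u) (by positivity)) (mul_nonneg (hd v) (by positivity))
        have hi : 0 ≤ G.deg u * G.deg v * inner ℝ (F u) (F v) ^ 2 :=
          mul_nonneg (mul_nonneg (hd u) (hd v)) (sq_nonneg _)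
        set D := ‖rankOne (F u) - rankOne (F v)‖ ^ 2 with hD
        have hD0 : 0 ≤ D := sq_nonneg _
        set a := G.deg u * G.deg v * (‖F u‖ ^ 2 * ‖F v‖ ^ 2 - inner ℝ (F u) (F v) ^ 2) with ha
        set mm := (G.deg u * ‖F u‖ ^ 2) * (G.deg v * ‖F v‖ ^ 2) with hmm
        set q := G.deg u * G.deg v * inner ℝ (F u) (F v) ^ 2 with hq
        have haq : a = mm - q := by rw [ha, hmm, hq]; ring
        have ha0 : 0 ≤ a := by rw [hov]; positivity
        have hk4i : 0 ≤ ((k : ℝ) ^ 4)⁻¹ := by positivity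
        rw [mul_pow, Real.sq_sqrt (by linarith)]
        -- Here `D` is a squared distance. Nearby lines: a ≤ mm/8 and a = mm - q give a ≤ q/7, for a
        -- total of at most k/7. Distant lines: the exponential is at most k⁻⁴, for a total of at
        -- most k⁻² ≤ 1/16. The sum is below k/4.
        rcases le_total D (1 / 4) with hD4 | hD4
        · have e1 : Real.exp (-(4 ^ 2 * Real.log k * D)) ≤ 1 :=
            Real.exp_le_one_iff.mpr (neg_nonpos.mpr (by positivity))
          have e2 : a ≤ mm * (1 / 8) := by
            rw [hov]; exact mul_le_mul_of_nonneg_left (by linarith) hm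
          have e3 := mul_le_mul_of_nonneg_left e1 ha0
          have e4 := mul_nonneg hm hk4i
          have e5 : a ≤ q * 7⁻¹ := by linarith
          exact e3.trans (by linarith)
        · have e1 : Real.exp (-(4 ^ 2 * Real.log k * D)) ≤ ((k : ℝ) ^ 4)⁻¹ := by
            rw [← hexp]
            exact Real.exp_le_exp.mpr (by nlinarith)
          have e2 : a ≤ mm := by linarith
          have e3 := mul_le_mul e2 e1 (Real.exp_nonneg _) hm
          linarith
      refine (Finset.sum_le_sum fun u _ => Finset.sum_le_sum fun v _ => h1 u v).trans ?_
      simp only [Finset.sum_add_distrib, ← Finset.sum_mul]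
      rw [G.sum_mass_mul_mass hF, G.sum_deg_mul_inner_sq hF]
      have e1 : (k : ℝ) ^ 2 * ((k : ℝ) ^ 4)⁻¹ ≤ 1 / 16 := by
        rw [← div_eq_mul_inv, div_le_iff₀ (by positivity)]
        nlinarith [mul_le_mul_of_nonneg_left (show (16 : ℝ) ≤ (k : ℝ) ^ 2 by nlinarith)
          (sq_nonneg (k : ℝ))]
      linarith)
  have hr4 : ((k / 4 : ℕ) : ℝ) ≤ k / 4 := by exact_mod_cast Nat.cast_div_le
  have hkN : k / 4 ≤ N := by
    have : ((k / 4 : ℕ) : ℝ) < N + 1 := by linarith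
    exact Nat.lt_succ_iff.mp (by exact_mod_cast this)
  refine ⟨_, _, hS.castLE hkN, fun i => ?_⟩
  have h1 := hc (Fin.castLE hkN i)
  have hik : ((i : ℕ) : ℝ) + 1 ≤ (k / 4 : ℕ) := by exact_mod_cast i.2
  rw [Fin.val_castLE] at h1
  set φ := G.bipartiteConductance (S (Fin.castLE hkN i)) (S' (Fin.castLE hkN i))
  have hφ : 0 ≤ φ := G.bipartiteConductance_nonneg _ _
  have hW := G.edgeCost_le hF hμ
  have hr := Real.sqrt_nonneg μ
  rw [Real.sqrt_mul (by linarith)]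
  refine le_of_mul_le_mul_left ?_ (show (0 : ℝ) < k / 4 by linarith)
  -- N exceeds k/2 - 1/2, so at least k/4 of the communities come no earlier than the i-th. The
  -- constant 2000 is needed here: 4 · 41 · 3 = 492 ≤ 2000/4.
  calc k / 4 * φ ≤ (N - (i : ℕ)) * φ := mul_le_mul_of_nonneg_right (by linarith) hφ
    _ ≤ 4 * (1 + 10 * (4 * √(Real.log k))) * G.edgeCost F := h1
    _ ≤ 4 * (1 + 10 * (4 * √(Real.log k))) * (3 * k * √μ) :=
        mul_le_mul_of_nonneg_left hW (by positivity)
    _ ≤ 4 * (41 * √(Real.log k)) * (3 * k * √μ) :=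
        mul_le_mul_of_nonneg_right (by linarith) (by positivity)
    _ ≤ k / 4 * (2000 * (√(Real.log k) * √μ)) := by
        have : 0 ≤ k * (√(Real.log k) * √μ) := by positivity
        nlinarith

end WeightedGraph

/-- Indices start at 0: `i + 1` is the position in the family, and the eigenvalue of index n - k is
λ_{n+1-k}. -/
theorem corollary4 :
    ∃ C : ℝ, 0 < C ∧
      ∀ (V : Type*) [Fintype V] [DecidableEq V] (G : WeightedGraph V), (∀ u, 0 < G.deg u) →
        ∀ (k : ℕ) (hk : 1 ≤ k) (hkn : k ≤ Fintype.card V),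
          (∃ S S' : Fin k → Finset V, WeightedGraph.IsCommunityFamily S S' ∧
            ∀ i : Fin k, G.bipartiteConductance (S i) (S' i) ≤
              C * ((k : ℝ) ^ 2 / ((k : ℝ) + 1 - ((i : ℕ) + 1 : ℝ))) *
                √(2 - G.eigenvalue ⟨Fintype.card V - k, by omega⟩)) ∧
          (∃ S S' : Fin (k / 4) → Finset V, WeightedGraph.IsCommunityFamily S S' ∧
            ∀ i : Fin (k / 4), G.bipartiteConductance (S i) (S' i) ≤
              C * √(Real.log k * (2 - G.eigenvalue ⟨Fintype.card V - k, by omega⟩))) := by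
  refine ⟨2000, by norm_num, fun V _ _ G hd k hk hkn => ?_⟩
  obtain ⟨F, hF, hμ⟩ :=
    G.exists_spectral_embedding hd hkn (j₀ := ⟨Fintype.card V - k, by omega⟩) rfl
  exact ⟨G.exists_communities_of_le hk (fun u => (hd u).le) hF hμ,
    G.exists_communities_quarter (fun u => (hd u).le) hF hμ⟩
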